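/- **Theorem (BS-FOLTL decidability).** Let $\Sigma$ be a signature with a finite non-empty set of sorts and finite sets of constant and relation symbols (no other function symbols), each constant having a sort and each relation symbol a finite sequence of argument sorts. Many-sorted first-order LTL (FOLTL) formulas over $\Sigma$ are the well-sorted formulas built from $\mathit{true}$, equalities $t=t'$ and atoms $R(t_1,\dots,t_k)$ (terms are variables and constants) with $\neg,\lor,\land,\exists x{:}s,\forall x{:}s$, next, until and release. They are interpreted over temporal structures, i.e. sequences of structures indexed by $\mathbb N$ that share their non-empty (finite or infinite) universes $(U_s)_s$ and the interpretation of the constants, while the relations may change over time; valuations of variables are rigid and sort-respecting. A formula is *satisfiable* if it holds at time $0$ of some temporal structure under some valuation, and *finitely satisfiable* if it does so in a temporal structure with finite universes. The projection of $\varphi$ on a sort $s$ is the one-sorted FOLTL formula obtained by removing all quantifications and all terms of sorts different from $s$ (relation symbols keep their argument positions of sort $s$, an equality or disequality between terms of another sort becomes $\mathit{true}$, and everything else is kept). The fragment *BS-FOLTL* consists of the closed formulas $\varphi$ in negation normal form (negation only in front of atomic formulas) such that, for each sort $s$, the projection of $\varphi$ on $s$ has the form $\exists x_1,\dots,x_k.\,\varphi'_s$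 with $k\ge 0$ and $\varphi'_s$ an FOLTL formula without existential quantifiers. 1. For every such $\Sigma$, a BS-FOLTL formula over $\Sigma$ is satisfiable if and only if it is finitely satisfiable. 2. BS-FOLTL is decidable: there is an algorithm which, given a (description of a) signature $\Sigma$ with sorts, constants and relation symbols numbered by initial segments of $\mathbb N$, and an FOLTL formula $\varphi$ over $\Sigma$, decides whether $\varphi$ is a satisfiable BS-FOLTL formula. In particular, satisfiability of BS-FOLTL formulas is decidable, uniformly in the signature. -/

import Mathlib

universe u

namespace FOLTL

/-- A many-sorted relational signature with sorts `S`, constant symbols `C` and relation symbols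
`R`: every constant has a sort and every relation symbol a finite sequence of argument sorts.
Finiteness of `S`, `C`, `R` and non-emptiness of `S` are imposed where signatures are used. -/
structure Signature (S C R : Type*) where
  constSort : C → S
  relArity : R → ℕ
  relSort : (r : R) → Fin (relArity r) → S

variable {S C R : Type*}

/-- Terms of a given sort: variables (countably many for each sort) and constant symbols. -/
inductive Term (σ : Signature S C R) : S → Type _
  | var (s : S) (x : ℕ) : Term σ s
  | const (c : C) : Term σ (σ.constSort c)

/-- Well-sorted first-order LTL formulas. The truth constant and the connectives `and`, `all`,
`release` are primitive here, as is usual for negation normal form. -/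
inductive Formula (σ : Signature S C R) : Type _
  | tru : Formula σ
  | eq {s : S} (t t' : Term σ s) : Formula σ
  | rel (r : R) (ts : (i : Fin (σ.relArity r)) → Term σ (σ.relSort r i)) : Formula σ
  | neg (φ : Formula σ) : Formula σ
  | or (φ ψ : Formula σ) : Formula σ
  | and (φ ψ : Formula σ) : Formula σ
  | ex (s : S) (x : ℕ) (φ : Formula σ) : Formula σ
  | all (s : S) (x : ℕ) (φ : Formula σ) : Formula σ
  | next (φ : Formula σ) : Formula σ
  | untl (φ ψ : Formula σ) : Formula σ
  | release (φ ψ : Formula σ) : Formula σ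

/-- A temporal structure: a sequence of structures with common non-empty universes `U s`, rigid
interpretation of the constants, and time-dependent interpretation of the relations. -/
structure TemporalStructure (σ : Signature S C R) where
  U : S → Type u
  nonempty : ∀ s, Nonempty (U s)
  const : (c : C) → U (σ.constSort c)
  rel : ℕ → (r : R) → Set ((i : Fin (σ.relArity r)) → U (σ.relSort r i))

variable {σ : Signature S C R}

/-- Sort-respecting valuations of the variables. -/
abbrev Valuation (T : TemporalStructure.{u} σ) := (s : S) → ℕ → T.U s

/-- The value of a term. -/
def Term.val (T : TemporalStructure.{u} σ) (ν : Valuation T) : {s : S} → Term σ s → T.U s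
  | _, .var s x => ν s x
  | _, .const c => T.const c

/-- `Formula.Sat T φ i ν`: the suffix `T[i,∞]` of `T` satisfies `φ` under the valuation `ν`. -/
def Formula.Sat [DecidableEq S] (T : TemporalStructure.{u} σ) :
    Formula σ → ℕ → Valuation T → Prop
  | .tru, _, _ => True
  | .eq t t', _, ν => t.val T ν = t'.val T ν
  | .rel r ts, i, ν => (fun j => (ts j).val T ν) ∈ T.rel i r
  | .neg φ, i, ν => ¬ φ.Sat T i ν
  | .or φ ψ, i, ν => φ.Sat T i ν ∨ ψ.Sat T i ν
  | .and φ ψ, i, ν => φ.Sat T i ν ∧ ψ.Sat T i ν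
  | .ex s x φ, i, ν =>
      ∃ d : T.U s, φ.Sat T i (Function.update ν s (Function.update (ν s) x d))
  | .all s x φ, i, ν =>
      ∀ d : T.U s, φ.Sat T i (Function.update ν s (Function.update (ν s) x d))
  | .next φ, i, ν => φ.Sat T (i + 1) ν
  | .untl φ ψ, i, ν => ∃ j, ψ.Sat T (i + j) ν ∧ ∀ k < j, φ.Sat T (i + k) ν
  | .release φ ψ, i, ν => ∀ j, ψ.Sat T (i + j) ν ∨ ∃ k < j, φ.Sat T (i + k) ν

/-- `release` is the dual of `untl`. -/
theorem Formula.sat_release_iff [DecidableEq S] (T : TemporalStructure.{u} σ)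
    (φ ψ : Formula σ) (i : ℕ) (ν : Valuation T) :
    (Formula.release φ ψ).Sat T i ν ↔ (Formula.neg (.untl (.neg φ) (.neg ψ))).Sat T i ν := by
  simp only [Formula.Sat, not_exists, not_and, not_forall, not_not, exists_prop]
  exact forall_congr' fun j => or_iff_not_imp_left

/-- `φ` holds in some temporal structure under some valuation. -/
def Formula.Satisfiable [DecidableEq S] (φ : Formula σ) : Prop :=
  ∃ (T : TemporalStructure.{u} σ) (ν : Valuation T), φ.Sat T 0 ν

/-- `φ` holds in some temporal structure with finite universes under some valuation. -/
def Formula.FinitelySatisfiable [DecidableEq S] (φ : Formula σ) : Prop :=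
  ∃ (T : TemporalStructure.{u} σ) (ν : Valuation T), (∀ s, Finite (T.U s)) ∧ φ.Sat T 0 ν

/-- The variables of a term, each with its sort. -/
def Term.fv : {s : S} → Term σ s → Set (S × ℕ)
  | _, .var s x => {(s, x)}
  | _, .const _ => ∅

/-- The free variables of a formula. -/
def Formula.fv : Formula σ → Set (S × ℕ)
  | .tru => ∅
  | .eq t t' => t.fv ∪ t'.fv
  | .rel _ ts => ⋃ i, (ts i).fv
  | .neg φ => φ.fv
  | .or φ ψ => φ.fv ∪ ψ.fv
  | .and φ ψ => φ.fv ∪ ψ.fv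
  | .ex s x φ => φ.fv \ {(s, x)}
  | .all s x φ => φ.fv \ {(s, x)}
  | .next φ => φ.fv
  | .untl φ ψ => φ.fv ∪ ψ.fv
  | .release φ ψ => φ.fv ∪ ψ.fv

/-- A closed formula has no free variables. -/
def Formula.IsClosed (φ : Formula σ) : Prop := φ.fv = ∅

/-- Atomic formulas. -/
def Formula.IsAtomic : Formula σ → Prop
  | .tru => True
  | .eq _ _ => True
  | .rel _ _ => True
  | _ => False

/-- Negation normal form: negation occurs only in front of atomic formulas. -/
def Formula.IsNNF : Formula σ → Prop
  | .tru => True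
  | .eq _ _ => True
  | .rel _ _ => True
  | .neg φ => φ.IsAtomic
  | .or φ ψ => φ.IsNNF ∧ ψ.IsNNF
  | .and φ ψ => φ.IsNNF ∧ ψ.IsNNF
  | .ex _ _ φ => φ.IsNNF
  | .all _ _ φ => φ.IsNNF
  | .next φ => φ.IsNNF
  | .untl φ ψ => φ.IsNNF ∧ ψ.IsNNF
  | .release φ ψ => φ.IsNNF ∧ ψ.IsNNF

/-- The formula contains no existential quantifier. -/
def Formula.NoExists : Formula σ → Prop
  | .tru => True
  | .eq _ _ => True
  | .rel _ _ => True
  | .neg φ => φ.NoExists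
  | .or φ ψ => φ.NoExists ∧ ψ.NoExists
  | .and φ ψ => φ.NoExists ∧ ψ.NoExists
  | .ex _ _ _ => False
  | .all _ _ φ => φ.NoExists
  | .next φ => φ.NoExists
  | .untl φ ψ => φ.NoExists ∧ ψ.NoExists
  | .release φ ψ => φ.NoExists ∧ ψ.NoExists

/-- Formulas `∃ x₁, …, xₖ. φ'` with `k ≥ 0` and no existential quantifier in `φ'`. -/
inductive Formula.IsExistsPrefixed : Formula σ → Prop
  | base {φ : Formula σ} : φ.NoExists → IsExistsPrefixed φ
  | ex {φ : Formula σ} (s : S) (x : ℕ) : IsExistsPrefixed φ → IsExistsPrefixed (.ex s x φ)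

section Projection

variable [DecidableEq S]

/-- The one-sorted signature obtained by keeping the constants of sort `s` and, for every relation
symbol, only its argument positions of sort `s`. -/
def Signature.proj (σ : Signature S C R) (s : S) :
    Signature Unit {c : C // σ.constSort c = s} R where
  constSort _ := ()
  relArity r := (Finset.univ.filter fun i => σ.relSort r i = s).card
  relSort _ _ := ()

/-- The `i`-th argument position of sort `s` of the relation symbol `r`. -/
def Signature.projPos (σ : Signature S C R) (s : S) (r : R) (i : Fin ((σ.proj s).relArity r)) :
    Fin (σ.relArity r) :=
  (Finset.univ.filter fun i => σ.relSort r i = s).orderEmbOfFin rfl i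

theorem Signature.relSort_projPos (σ : Signature S C R) (s : S) (r : R)
    (i : Fin ((σ.proj s).relArity r)) : σ.relSort r (σ.projPos s r i) = s :=
  (Finset.mem_filter.1
    ((Finset.univ.filter fun i => σ.relSort r i = s).orderEmbOfFin_mem rfl i)).2

/-- A term of sort `s` read as a term of the one-sorted signature. -/
def Term.proj (s : S) : {s' : S} → Term σ s' → s' = s → Term (σ.proj s) ()
  | _, .var _ x, _ => .var () x
  | _, .const c, h => .const (σ := σ.proj s) ⟨c, h⟩

/-- The projection of a formula on the sort `s`: all quantifications over other sorts and all terms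
of other sorts are removed. An equality or disequality between terms of another sort, of which
nothing remains, becomes the truth constant. -/
def Formula.proj (s : S) : Formula σ → Formula (σ.proj s)
  | .tru => .tru
  | .eq (s := s') t t' => if h : s' = s then .eq (t.proj s h) (t'.proj s h) else .tru
  | .rel r ts => .rel r fun i => (ts (σ.projPos s r i)).proj s (σ.relSort_projPos s r i)
  | .neg (.eq (s := s') t t') =>
      if h : s' = s then .neg (.eq (t.proj s h) (t'.proj s h)) else .tru
  | .neg φ => .neg (φ.proj s)
  | .or φ ψ => .or (φ.proj s) (ψ.proj s)
  | .and φ ψ => .and (φ.proj s) (ψ.proj s)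
  | .ex s' x φ => if s' = s then .ex () x (φ.proj s) else φ.proj s
  | .all s' x φ => if s' = s then .all () x (φ.proj s) else φ.proj s
  | .next φ => .next (φ.proj s)
  | .untl φ ψ => .untl (φ.proj s) (ψ.proj s)
  | .release φ ψ => .release (φ.proj s) (ψ.proj s)

/-- The Bernays–Schönfinkel-like fragment: closed formulas in negation normal form whose projection
on each sort is a string of existential quantifiers followed by a formula without existential
quantifiers. -/
def Formula.IsBS (φ : Formula σ) : Prop :=
  φ.IsClosed ∧ φ.IsNNF ∧ ∀ s, (φ.proj s).IsExistsPrefixed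

end Projection

section Code

variable {n m k : ℕ}

/-- The description of a finite signature as input of an algorithm: the number of sorts, the list
of the sorts of the constants, and the list of the argument sorts of the relation symbols. -/
def Signature.code (σ : Signature (Fin n) (Fin m) (Fin k)) : ℕ × List ℕ × List (List ℕ) :=
  (n, List.ofFn fun c => (σ.constSort c : ℕ),
    List.ofFn fun r => List.ofFn fun i => (σ.relSort r i : ℕ))

variable {τ : Signature (Fin n) (Fin m) (Fin k)}

/-- Gödel numbers of terms. -/
def Term.code : {s : Fin n} → Term τ s → ℕ
  | _, .var s x => Nat.pair 0 (Nat.pair s x)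
  | _, .const c => Nat.pair 1 c

/-- Gödel numbers of formulas. -/
def Formula.code : Formula τ → ℕ
  | .tru => Nat.pair 0 0
  | .eq t t' => Nat.pair 1 (Nat.pair t.code t'.code)
  | .rel r ts => Nat.pair 2 (Nat.pair r (Encodable.encode (List.ofFn fun i => (ts i).code)))
  | .neg φ => Nat.pair 3 φ.code
  | .or φ ψ => Nat.pair 4 (Nat.pair φ.code ψ.code)
  | .and φ ψ => Nat.pair 5 (Nat.pair φ.code ψ.code)
  | .ex s x φ => Nat.pair 6 (Nat.pair (Nat.pair s x) φ.code)
  | .all s x φ => Nat.pair 7 (Nat.pair (Nat.pair s x) φ.code)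
  | .next φ => Nat.pair 8 φ.code
  | .untl φ ψ => Nat.pair 9 (Nat.pair φ.code ψ.code)
  | .release φ ψ => Nat.pair 10 (Nat.pair φ.code ψ.code)

end Code

end FOLTL

/-! In the fragment, an existential quantifier over a sort `s` never lies in the scope of a
universal quantifier over `s`, nor of a Boolean or temporal connective
(`Formula.isExistsPrefixed_proj`). So all existentials sit in the initial quantifier prefix and are
evaluated at time 0. Start from the values of the constants and one element per sort, and walk
through the prefix with the finite set of valuations reached so far. An existential adds at most one
witness per valuation; a universal has to range only over the elements of its sort collected so far,
because that set is already final. Below the prefix no existential is left, and by negation normal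
form truth survives passage to the substructure. The universes obtained have a size doubly
exponential in the length of the prefix (`Formula.exists_satOn`, `Formula.IsBS.exists_small_model`),
which gives part 1.

For part 2, satisfiability in universes of bounded size is witnessed by a finite certificate. A
state is a set of pairs of a formula and a valuation, claimed to hold together. A certificate
consists of universes, a set of locally consistent states with successors, and, for each formula and
valuation, a strict order on states along which a pending until can be approached. The states being
finite in number, these orders are well-founded, and serving the obligations in turn yields a path
on which no until stays pending forever (`exists_fair_path`). By induction on the formula, every
claim along this path is true in the structure read off from the positive atoms
(`Formula.sat_of_bit`). Conversely, a small model labels each time with the formulas true then, and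
the shortest time to fulfilment orders the states (`Labels.met_or_timeToMeet_lt`,
`Formula.satCode_of_sat`).

All these objects are finite sets coded by binary digits of numbers below explicit bounds. Searching
for a certificate, and testing membership in the fragment, is therefore bounded quantification and
primitive recursive. -/

namespace FOLTL

/-! ### Finite models of bounded size -/

section SmallModel

variable {S C R : Type*} {σ : Signature S C R}

theorem Term.val_congr {T : TemporalStructure.{u} σ} {ν ν' : Valuation T} {s : S} (t : Term σ s)
    (h : ∀ s x, (s, x) ∈ t.fv → ν s x = ν' s x) : t.val T ν = t.val T ν' := by
  cases t with
  | var s x => exact h s x rfl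
  | const c => rfl

theorem Formula.isExistsPrefixed_ex (s : S) (x : ℕ) (φ : Formula σ) :
    (Formula.ex s x φ).IsExistsPrefixed ↔ φ.IsExistsPrefixed := by
  constructor
  · rintro (h | ⟨_, _, h⟩)
    · exact h.elim
    · exact h
  · exact .ex s x

theorem Formula.isExistsPrefixed_iff_noExists {φ : Formula σ} (h : ∀ s x ψ, φ ≠ .ex s x ψ) :
    φ.IsExistsPrefixed ↔ φ.NoExists := by
  constructor
  · rintro (h' | ⟨s, x, h'⟩)
    · exact h'
    · exact (h _ _ _ rfl).elim
  · exact .base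

variable [DecidableEq S]

/-- The valuation that maps the variable `x` of sort `s` to `d` and agrees with `ν` elsewhere. -/
def Valuation.assign {T : TemporalStructure.{u} σ} (ν : Valuation T) (s : S) (x : ℕ) (d : T.U s) :
    Valuation T :=
  Function.update ν s (Function.update (ν s) x d)

theorem Valuation.assign_self {T : TemporalStructure.{u} σ} (ν : Valuation T) (s : S) (x : ℕ)
    (d : T.U s) : ν.assign s x d s x = d := by
  simp [Valuation.assign]

theorem Valuation.assign_of_ne {T : TemporalStructure.{u} σ} (ν : Valuation T) {s s' : S}
    {x x' : ℕ} (d : T.U s) (h : (s', x') ≠ (s, x)) : ν.assign s x d s' x' = ν s' x' := by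
  unfold Valuation.assign
  by_cases hs : s' = s
  · subst hs
    have hx : x' ≠ x := fun hx => h (by rw [hx])
    simp [hx]
  · simp [hs]

/-- The truth of a formula depends only on the values of its free variables. -/
theorem Formula.sat_congr {T : TemporalStructure.{u} σ} (φ : Formula σ) :
    ∀ (i : ℕ) {ν ν' : Valuation T}, (∀ s x, (s, x) ∈ φ.fv → ν s x = ν' s x) →
      (φ.Sat T i ν ↔ φ.Sat T i ν') := by
  have hassign : ∀ (φ : Formula σ) (s : S) (x : ℕ) (ν ν' : Valuation T) (d : T.U s),
      (∀ s' x', (s', x') ∈ φ.fv \ {(s, x)} → ν s' x' = ν' s' x') →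
      ∀ s' x', (s', x') ∈ φ.fv → ν.assign s x d s' x' = ν'.assign s x d s' x' := by
    intro φ s x ν ν' d h s' x' hx'
    by_cases he : (s', x') = (s, x)
    · cases he
      rw [Valuation.assign_self, Valuation.assign_self]
    · rw [Valuation.assign_of_ne _ _ he, Valuation.assign_of_ne _ _ he]
      exact h s' x' ⟨hx', he⟩
  induction φ with
  | tru => exact fun _ _ _ _ => Iff.rfl
  | eq t t' =>
    intro i ν ν' h
    simp only [Formula.Sat]
    rw [t.val_congr fun s x hx => h s x (Or.inl hx), t'.val_congr fun s x hx => h s x (Or.inr hx)]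
  | rel r ts =>
    intro i ν ν' h
    simp only [Formula.Sat]
    rw [show (fun j => (ts j).val T ν) = fun j => (ts j).val T ν' from
      funext fun j => (ts j).val_congr fun s x hx => h s x (Set.mem_iUnion.2 ⟨j, hx⟩)]
  | neg φ ih => exact fun i ν ν' h => not_congr (ih i h)
  | or φ ψ ihφ ihψ =>
    exact fun i ν ν' h => or_congr (ihφ i fun s x hx => h s x (Or.inl hx))
      (ihψ i fun s x hx => h s x (Or.inr hx))
  | and φ ψ ihφ ihψ =>
    exact fun i ν ν' h => and_congr (ihφ i fun s x hx => h s x (Or.inl hx))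
      (ihψ i fun s x hx => h s x (Or.inr hx))
  | ex s x φ ih =>
    exact fun i ν ν' h => exists_congr fun d => ih i (hassign φ s x ν ν' d h)
  | all s x φ ih =>
    exact fun i ν ν' h => forall_congr' fun d => ih i (hassign φ s x ν ν' d h)
  | next φ ih => exact fun i ν ν' h => ih (i + 1) h
  | untl φ ψ ihφ ihψ =>
    exact fun i ν ν' h => exists_congr fun j =>
      and_congr (ihψ _ fun s x hx => h s x (Or.inr hx))
        (forall₂_congr fun k _ => ihφ _ fun s x hx => h s x (Or.inl hx))
  | release φ ψ ihφ ihψ =>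
    exact fun i ν ν' h => forall_congr' fun j =>
      or_congr (ihψ _ fun s x hx => h s x (Or.inr hx))
        (exists_congr fun k => and_congr_right fun _ => ihφ _ fun s x hx => h s x (Or.inl hx))

/-- Satisfaction with the quantifiers of each sort `s` bounded by `A s`. -/
def Formula.SatOn (T : TemporalStructure.{u} σ) (A : ∀ s, Set (T.U s)) :
    Formula σ → ℕ → Valuation T → Prop
  | .tru, _, _ => True
  | .eq t t', _, ν => t.val T ν = t'.val T ν
  | .rel r ts, i, ν => (fun j => (ts j).val T ν) ∈ T.rel i r
  | .neg φ, i, ν => ¬ φ.SatOn T A i ν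
  | .or φ ψ, i, ν => φ.SatOn T A i ν ∨ ψ.SatOn T A i ν
  | .and φ ψ, i, ν => φ.SatOn T A i ν ∧ ψ.SatOn T A i ν
  | .ex s x φ, i, ν => ∃ d ∈ A s, φ.SatOn T A i (ν.assign s x d)
  | .all s x φ, i, ν => ∀ d ∈ A s, φ.SatOn T A i (ν.assign s x d)
  | .next φ, i, ν => φ.SatOn T A (i + 1) ν
  | .untl φ ψ, i, ν => ∃ j, ψ.SatOn T A (i + j) ν ∧ ∀ k < j, φ.SatOn T A (i + k) ν
  | .release φ ψ, i, ν => ∀ j, ψ.SatOn T A (i + j) ν ∨ ∃ k < j, φ.SatOn T A (i + k) ν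

/-- The substructure with universes `A s`. -/
def TemporalStructure.restrict (T : TemporalStructure.{u} σ) (A : ∀ s, Set (T.U s))
    (hA : ∀ s, (A s).Nonempty) (hc : ∀ c, T.const c ∈ A (σ.constSort c)) :
    TemporalStructure.{u} σ where
  U s := A s
  nonempty s := (hA s).to_subtype
  const c := ⟨T.const c, hc c⟩
  rel i r := {v | (fun j => (v j).1) ∈ T.rel i r}

/-- Moves truth in a substructure back to the ambient structure, where one space of valuations
serves all candidate universes. -/
theorem Formula.sat_restrict (T : TemporalStructure.{u} σ) (A : ∀ s, Set (T.U s))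
    (hA : ∀ s, (A s).Nonempty) (hc : ∀ c, T.const c ∈ A (σ.constSort c)) (φ : Formula σ) :
    ∀ (i : ℕ) (ν : Valuation (T.restrict A hA hc)),
      φ.Sat (T.restrict A hA hc) i ν ↔ φ.SatOn T A i fun s x => (ν s x).1 := by
  have hval : ∀ (ν : Valuation (T.restrict A hA hc)) {s : S} (t : Term σ s),
      (t.val (T.restrict A hA hc) ν).1 = t.val T fun s x => (ν s x).1 := by
    intro ν s t
    cases t <;> rfl
  have hassign : ∀ (ν : Valuation (T.restrict A hA hc)) (s : S) (x : ℕ)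
      (d : (T.restrict A hA hc).U s), (fun s' x' => (ν.assign s x d s' x').1 : Valuation T) =
        Valuation.assign (T := T) (fun s x => (ν s x).1) s x d.1 := by
    intro ν s x d
    funext s' x'
    by_cases he : (s', x') = (s, x)
    · cases he
      exact (congrArg Subtype.val (ν.assign_self s x d)).trans
        (Valuation.assign_self (T := T) _ _ _ _).symm
    · exact (congrArg Subtype.val (ν.assign_of_ne d he)).trans
        (Valuation.assign_of_ne (T := T) (fun s x => (ν s x).1) d.1 he).symm
  induction φ with
  | tru => exact fun _ _ => Iff.rfl
  | eq t t' =>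
    intro i ν
    simp only [Formula.Sat, Formula.SatOn, ← hval]
    exact Subtype.ext_iff
  | rel r ts =>
    intro i ν
    simp only [Formula.Sat, Formula.SatOn, ← hval]
    rfl
  | neg φ ih => exact fun i ν => not_congr (ih i ν)
  | or φ ψ ihφ ihψ => exact fun i ν => or_congr (ihφ i ν) (ihψ i ν)
  | and φ ψ ihφ ihψ => exact fun i ν => and_congr (ihφ i ν) (ihψ i ν)
  | ex s x φ ih =>
    intro i ν
    refine Iff.trans (exists_congr fun d => ih i (ν.assign s x d)) ?_
    refine Iff.trans (exists_congr fun d => by rw [hassign]) ?_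
    exact ⟨fun ⟨d, h⟩ => ⟨d.1, d.2, h⟩, fun ⟨d, hd, h⟩ => ⟨⟨d, hd⟩, h⟩⟩
  | all s x φ ih =>
    intro i ν
    refine Iff.trans (forall_congr' fun d => ih i (ν.assign s x d)) ?_
    refine Iff.trans (forall_congr' fun d => by rw [hassign]) ?_
    exact Subtype.forall
  | next φ ih => exact fun i ν => ih (i + 1) ν
  | untl φ ψ ihφ ihψ =>
    exact fun i ν => exists_congr fun j => and_congr (ihψ _ ν) (forall₂_congr fun k _ => ihφ _ ν)
  | release φ ψ ihφ ihψ =>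
    exact fun i ν => forall_congr' fun j =>
      or_congr (ihψ _ ν) (exists_congr fun k => and_congr_right fun _ => ihφ _ ν)

/-- The formula contains no existential quantifier over the sort `s`. -/
def Formula.NoExistsOf (s : S) : Formula σ → Prop
  | .tru => True
  | .eq _ _ => True
  | .rel _ _ => True
  | .neg φ => φ.NoExistsOf s
  | .or φ ψ => φ.NoExistsOf s ∧ ψ.NoExistsOf s
  | .and φ ψ => φ.NoExistsOf s ∧ ψ.NoExistsOf s
  | .ex s' _ φ => s' ≠ s ∧ φ.NoExistsOf s
  | .all _ _ φ => φ.NoExistsOf s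
  | .next φ => φ.NoExistsOf s
  | .untl φ ψ => φ.NoExistsOf s ∧ ψ.NoExistsOf s
  | .release φ ψ => φ.NoExistsOf s ∧ ψ.NoExistsOf s

/-- The quantifiers over the sort `s` that are existential form a prefix, up to quantifiers over
other sorts. -/
def Formula.ExistsFirst (s : S) : Formula σ → Prop
  | .tru => True
  | .eq _ _ => True
  | .rel _ _ => True
  | .neg φ => φ.NoExistsOf s
  | .or φ ψ => φ.NoExistsOf s ∧ ψ.NoExistsOf s
  | .and φ ψ => φ.NoExistsOf s ∧ ψ.NoExistsOf s
  | .ex _ _ φ => φ.ExistsFirst s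
  | .all s' _ φ => (s' = s ∧ φ.NoExistsOf s) ∨ (s' ≠ s ∧ φ.ExistsFirst s)
  | .next φ => φ.NoExistsOf s
  | .untl φ ψ => φ.NoExistsOf s ∧ ψ.NoExistsOf s
  | .release φ ψ => φ.NoExistsOf s ∧ ψ.NoExistsOf s

theorem Formula.noExists_proj_neg (s : S) (φ : Formula σ) :
    ((Formula.neg φ).proj s).NoExists ↔ (φ.proj s).NoExists := by
  cases φ with
  | eq t t' =>
    simp only [Formula.proj]
    split_ifs <;> rfl
  | _ => exact Iff.rfl

theorem Formula.noExists_proj (s : S) (φ : Formula σ) :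
    (φ.proj s).NoExists ↔ φ.NoExistsOf s := by
  induction φ with
  | tru => exact Iff.rfl
  | eq t t' =>
    simp only [Formula.proj, Formula.NoExistsOf, iff_true]
    split_ifs <;> trivial
  | rel r ts => exact Iff.rfl
  | neg φ ih => rw [noExists_proj_neg, ih]; rfl
  | or φ ψ ihφ ihψ => exact and_congr ihφ ihψ
  | and φ ψ ihφ ihψ => exact and_congr ihφ ihψ
  | ex s' x φ ih =>
    simp only [Formula.proj, Formula.NoExistsOf]
    split_ifs with h
    · simp [Formula.NoExists, h]
    · simp [ih, h]
  | all s' x φ ih =>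
    simp only [Formula.proj, Formula.NoExistsOf]
    split_ifs with h
    · exact ih
    · exact ih
  | next φ ih => exact ih
  | untl φ ψ ihφ ihψ => exact and_congr ihφ ihψ
  | release φ ψ ihφ ihψ => exact and_congr ihφ ihψ

/-- Quantifiers over other sorts vanish under projection and so do not interrupt the prefix of sort
`s`; any head symbol other than a quantifier ends it. -/
theorem Formula.isExistsPrefixed_proj (s : S) (φ : Formula σ) :
    (φ.proj s).IsExistsPrefixed ↔ φ.ExistsFirst s := by
  have key : ∀ ψ : Formula σ, (∀ s' x χ, ψ.proj s ≠ .ex s' x χ) →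
      ((ψ.proj s).IsExistsPrefixed ↔ ψ.NoExistsOf s) := fun ψ h =>
    (isExistsPrefixed_iff_noExists h).trans (noExists_proj s ψ)
  induction φ with
  | tru => exact key _ (by simp [Formula.proj])
  | eq t t' => exact key _ (by intros; simp only [Formula.proj]; split_ifs <;> simp)
  | rel r ts => exact key _ (by simp [Formula.proj])
  | neg φ ih =>
    refine key _ ?_
    intro s' x χ
    cases φ with
    | eq t t' => simp only [Formula.proj]; split_ifs <;> simp
    | _ => simp [Formula.proj]
  | or φ ψ ihφ ihψ => exact key _ (by simp [Formula.proj])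
  | and φ ψ ihφ ihψ => exact key _ (by simp [Formula.proj])
  | ex s' x φ ih =>
    simp only [Formula.proj, Formula.ExistsFirst]
    split_ifs with h
    · exact (isExistsPrefixed_ex () x _).trans ih
    · exact ih
  | all s' x φ ih =>
    by_cases h : s' = s
    · simp only [Formula.proj, Formula.ExistsFirst, h, if_true, ne_eq, not_true, false_and,
        or_false, true_and, ← noExists_proj]
      exact isExistsPrefixed_iff_noExists (by simp)
    · simp [Formula.proj, Formula.ExistsFirst, h, ih]
  | next φ ih => exact key _ (by simp [Formula.proj])
  | untl φ ψ ihφ ihψ => exact key _ (by simp [Formula.proj])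
  | release φ ψ ihφ ihψ => exact key _ (by simp [Formula.proj])

/-- In negation normal form without existential quantifiers, truth is preserved by bounding the
quantifiers. -/
theorem Formula.satOn_of_sat {T : TemporalStructure.{u} σ} (A : ∀ s, Set (T.U s))
    (φ : Formula σ) (hnnf : φ.IsNNF) (hex : ∀ s, φ.NoExistsOf s) :
    ∀ (i : ℕ) (ν : Valuation T), φ.Sat T i ν → φ.SatOn T A i ν := by
  induction φ with
  | tru => exact fun _ _ h => h
  | eq t t' => exact fun _ _ h => h
  | rel r ts => exact fun _ _ h => h
  | neg φ _ =>
    intro i ν h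
    -- For atomic formulas, `Sat` and `SatOn` agree by definition.
    cases φ <;> first | exact h | exact hnnf.elim
  | or φ ψ ihφ ihψ =>
    exact fun i ν h => h.imp (ihφ hnnf.1 (fun s => (hex s).1) i ν)
      (ihψ hnnf.2 (fun s => (hex s).2) i ν)
  | and φ ψ ihφ ihψ =>
    exact fun i ν h => h.imp (ihφ hnnf.1 (fun s => (hex s).1) i ν)
      (ihψ hnnf.2 (fun s => (hex s).2) i ν)
  | ex s x φ _ => exact ((hex s).1 rfl).elim
  | all s x φ ih => exact fun i ν h d _ => ih hnnf hex i _ (h d)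
  | next φ ih => exact fun i ν h => ih hnnf hex (i + 1) ν h
  | untl φ ψ ihφ ihψ =>
    rintro i ν ⟨j, hj, h⟩
    exact ⟨j, ihψ hnnf.2 (fun s => (hex s).2) _ ν hj,
      fun k hk => ihφ hnnf.1 (fun s => (hex s).1) _ ν (h k hk)⟩
  | release φ ψ ihφ ihψ =>
    intro i ν h j
    exact (h j).imp (ihψ hnnf.2 (fun s => (hex s).2) _ ν)
      fun ⟨k, hk, h'⟩ => ⟨k, hk, ihφ hnnf.1 (fun s => (hex s).1) _ ν h'⟩

/-- The length of the maximal quantifier prefix. -/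
def Formula.quantPrefix : Formula σ → ℕ
  | .ex _ _ φ => φ.quantPrefix + 1
  | .all _ _ φ => φ.quantPrefix + 1
  | _ => 0

/-- Squaring the bound leaves room for `M` new witnesses beside `M` old elements, and can be
iterated. -/
theorem two_le_sq {M : ℕ} (hM : 2 ≤ M) : 2 * M ≤ M ^ 2 ∧ 2 ≤ M ^ 2 := by
  constructor <;> nlinarith

theorem pow_two_pow_succ (M k : ℕ) : (M ^ 2) ^ 2 ^ k = M ^ 2 ^ (k + 1) := by
  rw [← pow_mul, pow_succ' 2 k]

/-- Induction along the prefix, for all valuations in `V` at once; `A` holds the elements collected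
so far. Each quantifier at most squares the bound `M`: an existential adds a witness for each
valuation, a universal multiplies the valuations by the elements of `A s`. That sorts without
further existentials keep their set is part of the conclusion because the universal case depends on
it. -/
theorem Formula.exists_satOn {T : TemporalStructure.{u} σ} (i : ℕ) (φ : Formula σ)
    (hnnf : φ.IsNNF) (hex : ∀ s, φ.ExistsFirst s) :
    ∀ (M : ℕ) (A : ∀ s, Finset (T.U s)) (V : Finset (Valuation T)), 2 ≤ M →
      (∀ s, (A s).card ≤ M) → V.card ≤ M → (∀ ν ∈ V, φ.Sat T i ν) →
      ∃ A' : ∀ s, Finset (T.U s), (∀ s, A s ⊆ A' s) ∧ (∀ s, φ.NoExistsOf s → A' s = A s) ∧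
        (∀ s, (A' s).card ≤ M ^ 2 ^ φ.quantPrefix) ∧
        ∀ ν ∈ V, φ.SatOn T (fun s => A' s) i ν := by
  classical
  have hbase : ∀ ψ : Formula σ, ψ.IsNNF → (∀ s, ψ.NoExistsOf s) → ψ.quantPrefix = 0 →
      ∀ (M : ℕ) (A : ∀ s, Finset (T.U s)) (V : Finset (Valuation T)), 2 ≤ M →
      (∀ s, (A s).card ≤ M) → V.card ≤ M → (∀ ν ∈ V, ψ.Sat T i ν) →
      ∃ A' : ∀ s, Finset (T.U s), (∀ s, A s ⊆ A' s) ∧ (∀ s, ψ.NoExistsOf s → A' s = A s) ∧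
        (∀ s, (A' s).card ≤ M ^ 2 ^ ψ.quantPrefix) ∧
        ∀ ν ∈ V, ψ.SatOn T (fun s => A' s) i ν := by
    intro ψ hnnf hno hq M A V _ hA _ h
    exact ⟨A, fun s => Finset.Subset.refl _, fun _ _ => rfl, by simpa [hq] using hA,
      fun ν hν => ψ.satOn_of_sat _ hnnf hno i ν (h ν hν)⟩
  induction φ with
  | ex s x φ ih =>
    intro M A V hM hA hV h
    have := T.nonempty s
    choose! d hd using h
    obtain ⟨A', h1, h2, h3, h4⟩ := ih hnnf hex (M ^ 2)
      (Function.update A s (A s ∪ V.image d)) (V.image fun ν => ν.assign s x (d ν))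
      (two_le_sq hM).2
      (by
        intro s'
        by_cases hs : s' = s
        · subst hs
          rw [Function.update_self]
          have h1 := Finset.card_union_le (A s') (V.image d)
          have h2 := Finset.card_image_le (s := V) (f := d)
          have := (two_le_sq hM).1
          have := hA s'
          omega
        · rw [Function.update_of_ne hs]
          have := (two_le_sq hM).1
          have := hA s'
          omega)
      (Finset.card_image_le.trans (by have := (two_le_sq hM).1; omega))
      (by
        intro ν' hν'
        obtain ⟨ν, hν, rfl⟩ := Finset.mem_image.1 hν'
        exact hd ν hν)
    have hs : A s ∪ V.image d ⊆ A' s := by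
      have := h1 s
      rwa [Function.update_self] at this
    refine ⟨A', fun s' => ?_, fun s' hs' => ?_, fun s' => ?_, fun ν hν => ?_⟩
    · by_cases he : s' = s
      · subst he
        exact Finset.subset_union_left.trans hs
      · have := h1 s'
        rwa [Function.update_of_ne he] at this
    · rw [h2 s' hs'.2, Function.update_of_ne hs'.1.symm]
    · have := h3 s'
      rwa [pow_two_pow_succ] at this
    · exact ⟨d ν, hs (Finset.mem_union_right _ (Finset.mem_image_of_mem d hν)),
        h4 _ (Finset.mem_image_of_mem (fun ν => ν.assign s x (d ν)) hν)⟩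
  | all s x φ ih =>
    intro M A V hM hA hV h
    have hno : φ.NoExistsOf s := by
      rcases hex s with h | h
      · exact h.2
      · exact (h.1 rfl).elim
    have hex' : ∀ s', φ.ExistsFirst s' := by
      intro s'
      rcases hex s' with h | h
      · exact (φ.isExistsPrefixed_proj s').1 (.base ((φ.noExists_proj s').2 h.2))
      · exact h.2
    obtain ⟨A', h1, h2, h3, h4⟩ := ih hnnf hex' (M ^ 2) A
      ((V ×ˢ A s).image fun p => p.1.assign s x p.2) (two_le_sq hM).2
      (fun s' => (hA s').trans (by have := (two_le_sq hM).1; omega))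
      (by
        refine Finset.card_image_le.trans ?_
        rw [Finset.card_product, sq]
        exact Nat.mul_le_mul hV (hA s))
      (by
        intro ν' hν'
        obtain ⟨⟨ν, d⟩, hν, rfl⟩ := Finset.mem_image.1 hν'
        exact h ν (Finset.mem_product.1 hν).1 d)
    refine ⟨A', h1, h2, fun s' => ?_, fun ν hν d hd => ?_⟩
    · have := h3 s'
      rwa [pow_two_pow_succ] at this
    · have hd : d ∈ A' s := hd
      -- The set for `s` no longer grows below this quantifier, so `d` was among the elements for
      -- which the valuations were extended.
      rw [h2 s hno] at hd
      exact h4 _ (Finset.mem_image.2 ⟨(ν, d), Finset.mem_product.2 ⟨hν, hd⟩, rfl⟩)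
  | tru => exact hbase _ hnnf hex rfl
  | eq t t' => exact hbase _ hnnf hex rfl
  | rel r ts => exact hbase _ hnnf hex rfl
  | neg φ _ => exact hbase _ hnnf hex rfl
  | or φ ψ _ _ => exact hbase _ hnnf hex rfl
  | and φ ψ _ _ => exact hbase _ hnnf hex rfl
  | next φ _ => exact hbase _ hnnf hex rfl
  | untl φ ψ _ _ => exact hbase _ hnnf hex rfl
  | release φ ψ _ _ => exact hbase _ hnnf hex rfl

/-- Small model property: a satisfiable formula of the fragment has a model whose universes have a
size bounded in terms of the number of constants and the length of the quantifier prefix. -/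
theorem Formula.IsBS.exists_small_model [Finite C] {φ : Formula σ} (hφ : φ.IsBS)
    (hsat : Formula.Satisfiable.{u} φ) :
    ∃ (T : TemporalStructure.{u} σ) (ν : Valuation T),
      (∀ s, Finite (T.U s) ∧ Nat.card (T.U s) ≤ (Nat.card C + 2) ^ 2 ^ φ.quantPrefix) ∧
        φ.Sat T 0 ν := by
  classical
  obtain ⟨hclosed, hnnf, hex⟩ := hφ
  obtain ⟨T, ν, hν⟩ := hsat
  have := Fintype.ofFinite C
  let e : ∀ s, T.U s := fun s => (T.nonempty s).some
  -- As `φ` is closed, any valuation will do; this one takes its values in the universes to be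
  -- built.
  let ν₀ : Valuation T := fun s _ => e s
  have hν₀ : φ.Sat T 0 ν₀ :=
    (φ.sat_congr 0 fun s x hx => by rw [hclosed] at hx; exact hx.elim).1 hν
  let A : ∀ s, Finset (T.U s) := fun s =>
    insert (e s) (Finset.univ.image fun c =>
      if h : σ.constSort c = s then h ▸ T.const c else e s)
  -- The initial sets have at most `Nat.card C + 1` elements; one more makes the bound at least 2
  -- even without constants.
  obtain ⟨A', h1, -, h3, h4⟩ := φ.exists_satOn (T := T) 0 hnnf
    (fun s => (φ.isExistsPrefixed_proj s).1 (hex s)) (Nat.card C + 2) A {ν₀} (by omega)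
    (fun s => by
      refine (Finset.card_insert_le _ _).trans ?_
      have h : (Finset.univ.image fun c =>
        if h : σ.constSort c = s then h ▸ T.const c else e s).card ≤ Nat.card C := by
          refine Finset.card_image_le.trans ?_
          rw [Finset.card_univ, Nat.card_eq_fintype_card]
      omega) (by simp) (by simpa using hν₀)
  have he : ∀ s, e s ∈ A' s := fun s => h1 s (Finset.mem_insert_self _ _)
  have hc : ∀ c, T.const c ∈ A' (σ.constSort c) := fun c =>
    h1 _ (Finset.mem_insert_of_mem (Finset.mem_image.2 ⟨c, Finset.mem_univ _, by simp⟩))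
  refine ⟨T.restrict (fun s => A' s) (fun s => ⟨e s, he s⟩) hc, fun s _ => ⟨e s, he s⟩,
    fun s => ⟨?_, ?_⟩, ?_⟩
  · exact (A' s).finite_toSet.to_subtype
  · refine le_trans (le_of_eq ?_) (h3 s)
    exact (Nat.card_coe_set_eq _).trans (Set.ncard_coe_finset _)
  · exact (φ.sat_restrict T _ _ _ 0 _).2 (h4 ν₀ (Finset.mem_singleton_self _))

theorem Formula.IsBS.satisfiable_iff_finitelySatisfiable [Finite C] {φ : Formula σ}
    (hφ : φ.IsBS) :
    Formula.Satisfiable.{u} φ ↔ Formula.FinitelySatisfiable.{u} φ := by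
  constructor
  · intro h
    obtain ⟨T, ν, hT, hν⟩ := hφ.exists_small_model h
    exact ⟨T, ν, fun s => (hT s).1, hν⟩
  · rintro ⟨T, ν, -, hν⟩
    exact ⟨T, ν, hν⟩

end SmallModel

/-! ### Fair infinite paths -/

/-- A relation in which every obligation `u` is met (`G u`) or can be approached along a
well-founded relation `O u` has infinite paths along which every obligation is met infinitely
often. -/
theorem exists_fair_path {X : Type*} (step : X → X → Prop) (G : ℕ → X → Prop)
    (O : ℕ → X → X → Prop) (hO : ∀ u, WellFounded (O u)) (hstep : ∀ x, ∃ y, step x y)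
    (hG : ∀ u x, G u x ∨ ∃ y, step x y ∧ O u y x) (x₀ : X) :
    ∃ p : ℕ → X, p 0 = x₀ ∧ (∀ i, step (p i) (p (i + 1))) ∧ ∀ u i, ∃ j, i ≤ j ∧ G u (p j) := by
  classical
  choose succ hsucc using hstep
  have hG' : ∀ u x, ∃ y, step x y ∧ (G u x ∨ O u y x) := by
    intro u x
    rcases hG u x with h | ⟨y, hy, h⟩
    · exact ⟨succ x, hsucc x, Or.inl h⟩
    · exact ⟨y, hy, Or.inr h⟩
  choose next hnext hnext' using hG'
  -- Under this schedule every obligation recurs infinitely often. The second component of `q` is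
  -- the position in the schedule and advances only when the current obligation is met.
  let u : ℕ → ℕ := fun k => k.unpair.1
  let q : ℕ → X × ℕ := fun i => Nat.rec (x₀, 0)
    (fun _ y => (next (u y.2) y.1, if G (u y.2) y.1 then y.2 + 1 else y.2)) i
  have hq1 : ∀ i, (q (i + 1)).1 = next (u (q i).2) (q i).1 := fun i => rfl
  have hq2 : ∀ i, (q (i + 1)).2 = if G (u (q i).2) (q i).1 then (q i).2 + 1 else (q i).2 :=
    fun i => rfl
  have hmono : Monotone fun i => (q i).2 := by
    refine monotone_nat_of_le_succ fun i => ?_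
    rw [hq2]
    split_ifs <;> omega
  have hmeet : ∀ k x i, q i = (x, k) → ∃ j, i ≤ j ∧ (q j).2 = k ∧ G (u k) (q j).1 := by
    intro k x
    induction x using (hO (u k)).induction with
    | _ x ih =>
      intro i hi
      by_cases h : G (u k) x
      · exact ⟨i, le_rfl, by rw [hi], by rw [hi]; exact h⟩
      · have hi' : q (i + 1) = (next (u k) x, k) := by
          refine Prod.ext ?_ ?_
          · rw [hq1, hi]
          · rw [hq2, hi]
            simp [h]
        obtain ⟨j, hj, h'⟩ := ih _ ((hnext' (u k) x).resolve_left h) (i + 1) hi'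
        exact ⟨j, by omega, h'⟩
  have hreach : ∀ k, ∃ i, (q i).2 = k := by
    intro k
    induction k with
    | zero => exact ⟨0, rfl⟩
    | succ k ih =>
      obtain ⟨i, hi⟩ := ih
      obtain ⟨j, -, hj, h⟩ := hmeet k (q i).1 i (by rw [← hi])
      refine ⟨j + 1, ?_⟩
      rw [hq2, hj, if_pos h]
  refine ⟨fun i => (q i).1, rfl, fun i => hnext _ _, fun v i => ?_⟩
  -- A position assigned to `v` that lies beyond the one reached at `i`, hence is served later than
  -- `i`.
  obtain ⟨i', hi'⟩ := hreach (Nat.pair v ((q i).2 + 1))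
  obtain ⟨j, hj, hj', h⟩ := hmeet (Nat.pair v ((q i).2 + 1)) (q i').1 i' (by rw [← hi'])
  refine ⟨j, ?_, ?_⟩
  · by_contra hlt
    have h1 : (q j).2 ≤ (q i).2 := hmono (by omega)
    have h2 := Nat.right_le_pair v ((q i).2 + 1)
    omega
  · simpa [u] using h

/-! ### Finite sets coded by numbers -/

/-- `i` belongs to the finite set with binary code `c`. -/
def Bit (c i : ℕ) : Prop := c.testBit i = true

/-- Comprehension for coded sets. The bound on the code turns quantification over finite sets into
bounded quantification. -/
theorem exists_bits (b : ℕ) (p : ℕ → Prop) : ∃ c < 2 ^ b, ∀ i < b, Bit c i ↔ p i := by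
  classical
  refine ⟨Nat.ofBits fun i : Fin b => decide (p i), Nat.ofBits_lt_two_pow _, fun i hi => ?_⟩
  rw [Bit, Nat.testBit_ofBits_lt _ _ hi, decide_eq_true_iff]

theorem pair_lt_sq {a b n : ℕ} (ha : a < n) (hb : b < n) : Nat.pair a b < n ^ 2 :=
  (Nat.pair_lt_max_add_one_sq a b).trans_le (Nat.pow_le_pow_left (by omega) 2)

theorem exists_pair_bits (b : ℕ) (p : ℕ → ℕ → Prop) :
    ∃ c < 2 ^ b ^ 2, ∀ i < b, ∀ j < b, Bit c (Nat.pair i j) ↔ p i j := by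
  obtain ⟨c, hc, h⟩ := exists_bits (b ^ 2) fun n => p n.unpair.1 n.unpair.2
  exact ⟨c, hc, fun i hi j hj => by simpa using h _ (pair_lt_sq hi hj)⟩

/-! ### Closure properties of primitive recursive functions and predicates -/

section Primrec

variable {α β γ : Type} [Primcodable α] [Primcodable β] [Primcodable γ]

/-- Primitive recursive functions, as a property for `fun_prop`. -/
@[fun_prop] def PrimFun (f : α → β) : Prop := Primrec f

/-- Primitive recursive predicates, as a property for `fun_prop`. -/
@[fun_prop] def PrimRel (p : α → Prop) : Prop := PrimrecPred p

@[fun_prop] theorem PrimFun.id : PrimFun (fun a : α => a) := Primrec.id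

@[fun_prop] theorem PrimFun.const (b : β) : PrimFun (fun _ : α => b) := Primrec.const b

@[fun_prop] theorem PrimFun.comp {f : β → γ} {g : α → β} (hf : PrimFun f) (hg : PrimFun g) :
    PrimFun (fun a => f (g a)) := Primrec.comp hf hg

@[fun_prop] theorem PrimFun.fst {f : α → β × γ} (hf : PrimFun f) : PrimFun (fun a => (f a).1) :=
  Primrec.fst.comp hf

@[fun_prop] theorem PrimFun.snd {f : α → β × γ} (hf : PrimFun f) : PrimFun (fun a => (f a).2) :=
  Primrec.snd.comp hf

@[fun_prop] theorem PrimFun.natPair {f g : α → ℕ} (hf : PrimFun f) (hg : PrimFun g) :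
    PrimFun (fun a => Nat.pair (f a) (g a)) := Primrec₂.natPair.comp hf hg

@[fun_prop] theorem PrimFun.unpair {f : α → ℕ} (hf : PrimFun f) :
    PrimFun (fun a => Nat.unpair (f a)) := Primrec.unpair.comp hf

@[fun_prop] theorem PrimFun.add {f g : α → ℕ} (hf : PrimFun f) (hg : PrimFun g) :
    PrimFun (fun a => f a + g a) := Primrec.nat_add.comp hf hg

@[fun_prop] theorem PrimFun.pow {f g : α → ℕ} (hf : PrimFun f) (hg : PrimFun g) :
    PrimFun (fun a => f a ^ g a) :=
  (Primrec₂.unpaired'.1 Nat.Primrec.pow).comp hf hg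

@[fun_prop] theorem PrimFun.length {f : α → List β} (hf : PrimFun f) :
    PrimFun (fun a => (f a).length) := Primrec.list_length.comp hf

@[fun_prop] theorem PrimFun.getD {f : α → List ℕ} {g : α → ℕ} (hf : PrimFun f)
    (hg : PrimFun g) : PrimFun (fun a => (f a).getD (g a) 0) :=
  (Primrec.list_getD 0).comp hf hg

@[fun_prop] theorem PrimRel.and {p q : α → Prop} (hp : PrimRel p) (hq : PrimRel q) :
    PrimRel (fun a => p a ∧ q a) := PrimrecPred.and hp hq

@[fun_prop] theorem PrimRel.or {p q : α → Prop} (hp : PrimRel p) (hq : PrimRel q) :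
    PrimRel (fun a => p a ∨ q a) := PrimrecPred.or hp hq

@[fun_prop] theorem PrimRel.not {p : α → Prop} (hp : PrimRel p) :
    PrimRel (fun a => ¬ p a) := PrimrecPred.not hp

@[fun_prop] theorem PrimRel.iff {p q : α → Prop} (hp : PrimRel p) (hq : PrimRel q) :
    PrimRel (fun a => p a ↔ q a) :=
  ((hp.and hq).or (hp.not.and hq.not)).of_eq fun _ => iff_iff_and_or_not_and_not.symm

@[fun_prop] theorem PrimRel.eq {f g : α → ℕ} (hf : PrimFun f) (hg : PrimFun g) :
    PrimRel (fun a => f a = g a) := Primrec.eq.comp hf hg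

@[fun_prop] theorem PrimRel.lt {f g : α → ℕ} (hf : PrimFun f) (hg : PrimFun g) :
    PrimRel (fun a => f a < g a) := Primrec.nat_lt.comp hf hg

/-- Implication as a constant. -/
def Imp (p q : Prop) : Prop := p → q

/-- Bounded existential quantification as a constant. -/
def ExLt (b : ℕ) (p : ℕ → Prop) : Prop := ∃ x < b, p x

/-- Bounded universal quantification as a constant. -/
def AllLt (b : ℕ) (p : ℕ → Prop) : Prop := ∀ x < b, p x

@[fun_prop] theorem PrimRel.imp {p q : α → Prop} (hp : PrimRel p) (hq : PrimRel q) :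
    PrimRel (fun a => Imp (p a) (q a)) :=
  (hp.not.or hq).of_eq fun _ => imp_iff_not_or.symm

@[fun_prop] theorem PrimRel.exLt {b : α → ℕ} {p : α → ℕ → Prop} (hb : PrimFun b)
    (hp : PrimRel (fun q : α × ℕ => p q.1 q.2)) : PrimRel (fun a => ExLt (b a) (p a)) := by
  have h : PrimrecRel fun (x : ℕ) (a : α) => p a x := PrimrecPred.comp hp (Primrec.pair .snd .fst)
  refine PrimrecPred.of_eq (PrimrecPred.comp (PrimrecRel.exists_mem_list h)
    (Primrec.pair (Primrec.list_range.comp hb) Primrec.id)) ?_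
  simp [ExLt]

@[fun_prop] theorem PrimRel.allLt {b : α → ℕ} {p : α → ℕ → Prop} (hb : PrimFun b)
    (hp : PrimRel (fun q : α × ℕ => p q.1 q.2)) : PrimRel (fun a => AllLt (b a) (p a)) := by
  have h : PrimrecRel fun (x : ℕ) (a : α) => p a x := PrimrecPred.comp hp (Primrec.pair .snd .fst)
  refine PrimrecPred.of_eq (PrimrecPred.comp (PrimrecRel.forall_mem_list h)
    (Primrec.pair (Primrec.list_range.comp hb) Primrec.id)) ?_
  simp [AllLt]

@[fun_prop] theorem PrimRel.bit {f g : α → ℕ} (hf : PrimFun f) (hg : PrimFun g) :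
    PrimRel (fun a => Bit (f a) (g a)) := by
  have h : PrimrecPred fun a => f a / 2 ^ g a % 2 = 1 :=
    Primrec.eq.comp (Primrec.nat_mod.comp (Primrec.nat_div.comp hf
      (PrimFun.pow (PrimFun.const 2) hg)) (Primrec.const 2)) (Primrec.const 1)
  exact h.of_eq fun a => by rw [Bit, Nat.testBit_eq_decide_div_mod_eq, decide_eq_true_iff]

end Primrec

/-! ### Decoding formulas -/

section Codes

/-- The head symbol of a formula code. -/
def tag (ψ : ℕ) : ℕ := ψ.unpair.1

/-- What follows the head symbol of a formula code. -/
def arg (ψ : ℕ) : ℕ := ψ.unpair.2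

/-- The first of two arguments of a formula code. -/
def argL (ψ : ℕ) : ℕ := (arg ψ).unpair.1

/-- The second of two arguments of a formula code. -/
def argR (ψ : ℕ) : ℕ := (arg ψ).unpair.2

/-- The sort of the quantified variable of a formula code. -/
def argS (ψ : ℕ) : ℕ := (argL ψ).unpair.1

/-- The codes of the arguments of a relational atom. -/
def argTerms (ψ : ℕ) : List ℕ := Denumerable.ofNat (List ℕ) (argR ψ)

@[simp] theorem tag_pair (a b : ℕ) : tag (Nat.pair a b) = a := by simp [tag]
@[simp] theorem arg_pair (a b : ℕ) : arg (Nat.pair a b) = b := by simp [arg]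
@[simp] theorem argL_pair (a b c : ℕ) : argL (Nat.pair a (Nat.pair b c)) = b := by simp [argL]
@[simp] theorem argR_pair (a b c : ℕ) : argR (Nat.pair a (Nat.pair b c)) = c := by simp [argR]
@[simp] theorem argS_pair (a b c d : ℕ) :
    argS (Nat.pair a (Nat.pair (Nat.pair b c) d)) = b := by simp [argS]
@[simp] theorem argTerms_pair (a b : ℕ) (l : List ℕ) :
    argTerms (Nat.pair a (Nat.pair b (Encodable.encode l))) = l := by
  rw [argTerms, argR_pair]
  exact Denumerable.ofNat_encode l

variable {α : Type} [Primcodable α] {f : α → ℕ}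

@[fun_prop] theorem PrimFun.tag (hf : PrimFun f) : PrimFun (fun a => tag (f a)) :=
  hf.unpair.fst

@[fun_prop] theorem PrimFun.arg (hf : PrimFun f) : PrimFun (fun a => arg (f a)) :=
  hf.unpair.snd

@[fun_prop] theorem PrimFun.argL (hf : PrimFun f) : PrimFun (fun a => argL (f a)) :=
  hf.arg.unpair.fst

@[fun_prop] theorem PrimFun.argR (hf : PrimFun f) : PrimFun (fun a => argR (f a)) :=
  hf.arg.unpair.snd

@[fun_prop] theorem PrimFun.argS (hf : PrimFun f) : PrimFun (fun a => argS (f a)) :=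
  hf.argL.unpair.fst

@[fun_prop] theorem PrimFun.argTerms (hf : PrimFun f) : PrimFun (fun a => argTerms (f a)) :=
  (Primrec.ofNat (List ℕ)).comp hf.argR

end Codes

/-! ### Membership in the fragment, on codes -/

section SyntacticConditions

/-- All immediate subformulas of `ψ` belong to the set coded by `c`. -/
def Subs (c ψ : ℕ) : Prop :=
  Imp (tag ψ = 3 ∨ tag ψ = 8) (Bit c (arg ψ)) ∧
  Imp (tag ψ = 4 ∨ tag ψ = 5 ∨ tag ψ = 9 ∨ tag ψ = 10) (Bit c (argL ψ) ∧ Bit c (argR ψ)) ∧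
  Imp (tag ψ = 6 ∨ tag ψ = 7) (Bit c (argR ψ))

/-- `φ` belongs to a finite set of codes `< b` that contains, with each `ψ`, all immediate
subformulas of `ψ`, unless `e ψ` holds, and whose elements satisfy `e` or `l`. -/
def Hereditary (b : ℕ) (e l : ℕ → Prop) (φ : ℕ) : Prop :=
  ExLt (2 ^ b) fun c => Bit c φ ∧ AllLt b fun ψ => Imp (Bit c ψ) (e ψ ∨ l ψ ∧ Subs c ψ)

/-- `Formula.IsNNF` on codes. -/
def NNFCode (b φ : ℕ) : Prop :=
  Hereditary b (fun ψ => tag ψ = 3 ∧ tag (arg ψ) < 3) (fun ψ => ¬ tag ψ = 3) φ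

/-- `Formula.NoExistsOf` on codes. -/
def NoExistsCode (b s φ : ℕ) : Prop :=
  Hereditary b (fun ψ => tag ψ = 0) (fun ψ => Imp (tag ψ = 6) (¬ argS ψ = s)) φ

/-- `Formula.ExistsFirst` on codes. -/
def ExistsFirstCode (b s φ : ℕ) : Prop :=
  Hereditary b (fun ψ => NoExistsCode b s ψ)
    (fun ψ => tag ψ = 6 ∨ tag ψ = 7 ∧ ¬ argS ψ = s) φ

/-- The variable with code `v` is not free in the formula with code `φ`. -/
def NotFreeCode (b v φ : ℕ) : Prop :=
  Hereditary b (fun ψ => (tag ψ = 6 ∨ tag ψ = 7) ∧ Nat.pair 0 (argL ψ) = v)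
    (fun ψ => Imp (tag ψ = 1) (¬ argL ψ = v ∧ ¬ argR ψ = v) ∧
      Imp (tag ψ = 2) (AllLt (argTerms ψ).length fun i => ¬ (argTerms ψ).getD i 0 = v)) φ

/-- `Formula.IsBS` on codes. -/
def BSCode (b n φ : ℕ) : Prop :=
  (AllLt b fun v => NotFreeCode b (Nat.pair 0 v) φ) ∧ NNFCode b φ ∧ AllLt n fun s => ExistsFirstCode b s φ

variable {α : Type} [Primcodable α] {b c n s φ ψ v : α → ℕ}

@[fun_prop] theorem PrimRel.subs (hc : PrimFun c) (hψ : PrimFun ψ) :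
    PrimRel fun a => Subs (c a) (ψ a) := by
  unfold Subs
  fun_prop

@[fun_prop] theorem PrimRel.hereditary {e l : α → ℕ → Prop} (hb : PrimFun b)
    (he : PrimRel fun q : α × ℕ => e q.1 q.2) (hl : PrimRel fun q : α × ℕ => l q.1 q.2)
    (hφ : PrimFun φ) : PrimRel fun a => Hereditary (b a) (e a) (l a) (φ a) := by
  have hp : Primrec fun q : (α × ℕ) × ℕ => (q.1.1, q.2) :=
    Primrec.pair (Primrec.fst.comp .fst) .snd
  have he' : PrimRel fun q : (α × ℕ) × ℕ => e q.1.1 q.2 := PrimrecPred.comp he hp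
  have hl' : PrimRel fun q : (α × ℕ) × ℕ => l q.1.1 q.2 := PrimrecPred.comp hl hp
  exact PrimRel.exLt (by fun_prop) (PrimRel.and (by fun_prop)
    (PrimRel.allLt (by fun_prop) (PrimRel.imp (by fun_prop)
      (he'.or (hl'.and (by fun_prop))))))

@[fun_prop] theorem PrimRel.nnfCode (hb : PrimFun b) (hφ : PrimFun φ) :
    PrimRel fun a => NNFCode (b a) (φ a) := by
  unfold NNFCode
  fun_prop

@[fun_prop] theorem PrimRel.noExistsCode (hb : PrimFun b) (hs : PrimFun s) (hφ : PrimFun φ) :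
    PrimRel fun a => NoExistsCode (b a) (s a) (φ a) := by
  unfold NoExistsCode
  fun_prop

@[fun_prop] theorem PrimRel.existsFirstCode (hb : PrimFun b) (hs : PrimFun s) (hφ : PrimFun φ) :
    PrimRel fun a => ExistsFirstCode (b a) (s a) (φ a) := by
  unfold ExistsFirstCode
  fun_prop

@[fun_prop] theorem PrimRel.notFreeCode (hb : PrimFun b) (hv : PrimFun v) (hφ : PrimFun φ) :
    PrimRel fun a => NotFreeCode (b a) (v a) (φ a) := by
  unfold NotFreeCode
  fun_prop

@[fun_prop] theorem PrimRel.bsCode (hb : PrimFun b) (hn : PrimFun n) (hφ : PrimFun φ) :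
    PrimRel fun a => BSCode (b a) (n a) (φ a) := by
  unfold BSCode
  fun_prop

end SyntacticConditions

theorem le_pair_pair_left (a b c : ℕ) : b ≤ Nat.pair a (Nat.pair b c) :=
  (Nat.left_le_pair b c).trans (Nat.right_le_pair _ _)

theorem le_pair_pair_right (a b c : ℕ) : c ≤ Nat.pair a (Nat.pair b c) :=
  (Nat.right_le_pair b c).trans (Nat.right_le_pair _ _)

theorem le_encode_of_mem {a : ℕ} : ∀ {l : List ℕ}, a ∈ l → a ≤ Encodable.encode l
  | [], h => by simp at h
  | b :: l, h => by
    rw [Encodable.encode_list_cons]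
    rcases List.mem_cons.1 h with rfl | h
    · exact (Nat.left_le_pair _ _).trans (Nat.le_succ _)
    · exact (le_encode_of_mem h).trans ((Nat.right_le_pair _ _).trans (Nat.le_succ _))

/-! ### Correctness of the syntactic conditions -/

section SyntacticCodes

variable {n m k : ℕ} {τ : Signature (Fin n) (Fin m) (Fin k)}

/-- The immediate subformulas. -/
def Formula.children : Formula τ → List (Formula τ)
  | .tru => []
  | .eq _ _ => []
  | .rel _ _ => []
  | .neg φ => [φ]
  | .or φ ψ => [φ, ψ]
  | .and φ ψ => [φ, ψ]
  | .ex _ _ φ => [φ]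
  | .all _ _ φ => [φ]
  | .next φ => [φ]
  | .untl φ ψ => [φ, ψ]
  | .release φ ψ => [φ, ψ]

theorem Formula.children_induction {P : Formula τ → Prop}
    (h : ∀ χ : Formula τ, (∀ φ ∈ χ.children, P φ) → P χ) (χ : Formula τ) : P χ := by
  induction χ <;> exact h _ (by simp_all [Formula.children])

theorem Formula.code_le_of_mem_children {φ χ : Formula τ} (h : φ ∈ χ.children) :
    φ.code ≤ χ.code := by
  cases χ <;> simp only [Formula.children, List.mem_cons, List.not_mem_nil, or_false] at h
  case neg => exact h ▸ Nat.right_le_pair _ _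
  case next => exact h ▸ Nat.right_le_pair _ _
  case ex => exact h ▸ le_pair_pair_right _ _ _
  case all => exact h ▸ le_pair_pair_right _ _ _
  all_goals
    rcases h with rfl | rfl
    · exact le_pair_pair_left _ _ _
    · exact le_pair_pair_right _ _ _

theorem subs_code (c : ℕ) (χ : Formula τ) :
    Subs c χ.code ↔ ∀ φ ∈ χ.children, Bit c φ.code := by
  cases χ <;> simp [Subs, Imp, Formula.code, Formula.children]

/-- Replaces recursion on formulas by search for a set. Membership in a hereditary set forces `P` by
induction on subformulas; conversely, the codes below `b` of all formulas with `P` form such a set.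
Members that code no formula do no harm, as the induction visits only subformulas of `φ`. -/
theorem hereditary_code_iff {b : ℕ} {e l : ℕ → Prop} {P : Formula τ → Prop}
    (hP : ∀ χ : Formula τ, χ.code < b →
      (P χ ↔ e χ.code ∨ l χ.code ∧ ∀ φ ∈ χ.children, P φ))
    {φ : Formula τ} (hφ : φ.code < b) : Hereditary b e l φ.code ↔ P φ := by
  constructor
  · rintro ⟨c, -, hc, h⟩
    have key : ∀ χ : Formula τ, χ.code < b → Bit c χ.code → P χ := by
      intro χ
      induction χ using Formula.children_induction with
      | h χ ih =>
        intro hχ hcχ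
        refine (hP χ hχ).2 ((h _ hχ hcχ).imp_right fun ⟨hl, hs⟩ => ⟨hl, fun φ hφ => ?_⟩)
        exact ih φ hφ ((Formula.code_le_of_mem_children hφ).trans_lt hχ)
          ((subs_code c χ).1 hs φ hφ)
    exact key φ hφ hc
  · intro h
    obtain ⟨c, hcb, hc⟩ := exists_bits b fun ψ => ∃ χ : Formula τ, χ.code = ψ ∧ P χ
    refine ⟨c, hcb, (hc _ hφ).2 ⟨φ, rfl, h⟩, fun ψ hψ hcψ => ?_⟩
    obtain ⟨χ, rfl, hχ⟩ := (hc _ hψ).1 hcψ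
    refine ((hP χ hψ).1 hχ).imp_right fun ⟨hl, hs⟩ => ⟨hl, (subs_code c χ).2 fun φ hφ => ?_⟩
    exact (hc _ ((Formula.code_le_of_mem_children hφ).trans_lt hψ)).2 ⟨φ, rfl, hs φ hφ⟩

theorem nnfCode_iff {b : ℕ} {φ : Formula τ} (hφ : φ.code < b) :
    NNFCode b φ.code ↔ φ.IsNNF := by
  refine hereditary_code_iff (fun χ _ => ?_) hφ
  cases χ with
  | neg χ => cases χ <;> simp [Formula.code, Formula.IsNNF, Formula.IsAtomic]
  | _ => simp [Formula.code, Formula.children, Formula.IsNNF]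

theorem noExistsCode_iff {b : ℕ} {s : Fin n} {φ : Formula τ} (hφ : φ.code < b) :
    NoExistsCode b s φ.code ↔ φ.NoExistsOf s := by
  refine hereditary_code_iff (fun χ _ => ?_) hφ
  cases χ <;> simp [Formula.code, Formula.children, Formula.NoExistsOf, Imp, Fin.val_inj]

theorem Formula.NoExistsOf.existsFirst {s : Fin n} {φ : Formula τ} (h : φ.NoExistsOf s) :
    φ.ExistsFirst s :=
  (φ.isExistsPrefixed_proj s).1 (.base ((φ.noExists_proj s).2 h))

/-- The exit condition may be used at any node, because a formula without existentials over `s`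
satisfies `ExistsFirst s`. -/
theorem existsFirstCode_iff {b : ℕ} {s : Fin n} {φ : Formula τ} (hφ : φ.code < b) :
    ExistsFirstCode b s φ.code ↔ φ.ExistsFirst s := by
  refine hereditary_code_iff (fun χ hχ => ?_) hφ
  rw [noExistsCode_iff hχ]
  have h := fun φ : Formula τ => Formula.NoExistsOf.existsFirst (s := s) (φ := φ)
  cases χ with
  | ex s' x χ =>
    have := h χ
    simp only [Formula.code, Formula.children, Formula.NoExistsOf, Formula.ExistsFirst, tag_pair,
      argS_pair, Fin.val_inj, List.mem_singleton, forall_eq]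
    tauto
  | all s' x χ =>
    have := h χ
    simp only [Formula.code, Formula.children, Formula.NoExistsOf, Formula.ExistsFirst, tag_pair,
      argS_pair, Fin.val_inj, List.mem_singleton, forall_eq]
    by_cases hs : s' = s <;> simp [hs]
    exact h χ
  | _ => simp [Formula.code, Formula.NoExistsOf, Formula.ExistsFirst]

/-- The Gödel number of a variable. -/
def varCode (p : Fin n × ℕ) : ℕ := Nat.pair 0 (Nat.pair p.1 p.2)

theorem varCode_injective : Function.Injective (varCode (n := n)) := by
  rintro ⟨s, x⟩ ⟨s', x'⟩ h
  simpa [varCode, Fin.val_inj] using h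

/-- The hypothesis on `v` rules out codes of constants. -/
theorem Term.forall_fv_iff {s : Fin n} (t : Term τ s) {v : ℕ} (hv : v.unpair.1 = 0) :
    (∀ p ∈ t.fv, varCode p ≠ v) ↔ ¬ t.code = v := by
  cases t with
  | var s x => simp [Term.fv, Term.code, varCode]
  | const c =>
    simp only [Term.fv, Term.code, Set.mem_empty_iff_false, false_imp_iff, implies_true, true_iff]
    rintro rfl
    simp at hv

theorem Formula.forall_fv_diff {φ : Formula τ} (p : Fin n × ℕ) (v : ℕ) :
    (∀ q ∈ φ.fv \ {p}, varCode q ≠ v) ↔ varCode p = v ∨ ∀ q ∈ φ.fv, varCode q ≠ v := by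
  constructor
  · intro h
    by_cases hv : varCode p = v
    · exact Or.inl hv
    · refine Or.inr fun q hq => ?_
      by_cases hqp : q = p
      · exact hqp ▸ hv
      · exact h q ⟨hq, hqp⟩
  · rintro (rfl | h) q hq
    · exact fun h => hq.2 (varCode_injective h)
    · exact h q hq.1

theorem notFreeCode_iff {b v : ℕ} (hv : v.unpair.1 = 0) {φ : Formula τ} (hφ : φ.code < b) :
    NotFreeCode b v φ.code ↔ ∀ p ∈ φ.fv, varCode p ≠ v := by
  refine hereditary_code_iff (P := fun φ => ∀ p ∈ φ.fv, varCode p ≠ v) (fun χ _ => ?_) hφ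
  have hor : ∀ A B : Set (Fin n × ℕ), (∀ p ∈ A ∪ B, varCode p ≠ v) ↔
      (∀ p ∈ A, varCode p ≠ v) ∧ ∀ p ∈ B, varCode p ≠ v := fun A B => by
    simp only [Set.mem_union, or_imp, forall_and]
  cases χ with
  | eq t t' =>
    rw [Formula.fv, hor, t.forall_fv_iff hv, t'.forall_fv_iff hv]
    simp [Formula.code, Formula.children, Imp]
  | rel r ts =>
    have : (∀ p ∈ (Formula.rel r ts).fv, varCode p ≠ v) ↔ ∀ i, ¬ (ts i).code = v := by
      simp only [Formula.fv, Set.mem_iUnion, ← (ts _).forall_fv_iff hv]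
      exact ⟨fun h i p hp => h p ⟨i, hp⟩, fun h p ⟨i, hp⟩ => h i p hp⟩
    rw [this]
    simp only [Formula.code, Formula.children, Imp, tag_pair, argTerms_pair, AllLt,
      List.length_ofFn]
    simp +contextual [Fin.forall_iff]
  | ex s x χ =>
    refine (Formula.forall_fv_diff (s, x) v).trans ?_
    simp [Formula.code, Formula.children, Imp, varCode]
  | all s x χ =>
    refine (Formula.forall_fv_diff (s, x) v).trans ?_
    simp [Formula.code, Formula.children, Imp, varCode]
  | _ =>
    simp only [Formula.fv, hor]
    simp [Formula.code, Formula.children, Imp]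

theorem Formula.varCode_le_code (φ : Formula τ) : ∀ p ∈ φ.fv, varCode p ≤ φ.code := by
  have hterm : ∀ {s : Fin n} (t : Term τ s), ∀ p ∈ t.fv, varCode p ≤ t.code := by
    intro s t p hp
    cases t with
    | var s x => exact le_of_eq (congrArg varCode (Set.mem_singleton_iff.1 hp))
    | const c => exact hp.elim
  induction φ with
  | tru => exact fun p hp => hp.elim
  | eq t t' =>
    rintro p (hp | hp)
    · exact (hterm t p hp).trans (le_pair_pair_left _ _ _)
    · exact (hterm t' p hp).trans (le_pair_pair_right _ _ _)
  | rel r ts =>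
    intro p hp
    obtain ⟨i, hi⟩ := Set.mem_iUnion.1 hp
    have h : (ts i).code ∈ List.ofFn fun i => (ts i).code := List.mem_ofFn.2 ⟨i, rfl⟩
    exact (hterm (ts i) p hi).trans ((le_encode_of_mem h).trans (le_pair_pair_right _ _ _))
  | neg φ ih => exact fun p hp => (ih p hp).trans (Nat.right_le_pair _ _)
  | next φ ih => exact fun p hp => (ih p hp).trans (Nat.right_le_pair _ _)
  | ex s x φ ih => exact fun p hp => (ih p hp.1).trans (le_pair_pair_right _ _ _)
  | all s x φ ih => exact fun p hp => (ih p hp.1).trans (le_pair_pair_right _ _ _)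
  | _ φ ψ ihφ ihψ =>
    rintro p (hp | hp)
    · exact (ihφ p hp).trans (le_pair_pair_left _ _ _)
    · exact (ihψ p hp).trans (le_pair_pair_right _ _ _)

/-- Closedness becomes a bounded test because the code of a free variable does not exceed that of
the formula. -/
theorem bsCode_iff {b : ℕ} {φ : Formula τ} (hφ : φ.code < b) :
    BSCode b n φ.code ↔ φ.IsBS := by
  refine and_congr ?_ (and_congr (nnfCode_iff hφ) ?_)
  · constructor
    · intro h
      refine Set.eq_empty_iff_forall_notMem.2 fun p hp => ?_
      exact (notFreeCode_iff (v := Nat.pair 0 (Nat.pair p.1 p.2)) (by simp) hφ).1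
        (h _ (((Nat.right_le_pair _ _).trans (φ.varCode_le_code p hp)).trans_lt hφ)) p hp rfl
    · intro h v _
      refine (notFreeCode_iff (by simp) hφ).2 fun p hp => ?_
      rw [show φ.fv = ∅ from h] at hp
      exact hp.elim
  · simp only [φ.isExistsPrefixed_proj]
    exact ⟨fun h s => (existsFirstCode_iff hφ).1 (h s s.2),
      fun h s hs => (existsFirstCode_iff (s := ⟨s, hs⟩) hφ).2 (h _)⟩

end SyntacticCodes

/-! ### Certificates for satisfiability -/

section Certificate

/-- Under the valuation `ν`, the equality with code `ψ` is true. -/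
def EqTrue (b ν ψ : ℕ) : Prop :=
  ExLt b fun a => Bit ν (Nat.pair (argL ψ) a) ∧ Bit ν (Nat.pair (argR ψ) a)

/-- The valuation `ν'` arises from `ν` by giving the term `v` the value `a`. -/
def Update (b ν ν' v a : ℕ) : Prop :=
  AllLt b fun t => AllLt b fun x =>
    Bit ν' (Nat.pair t x) ↔ t = v ∧ x = a ∨ ¬ t = v ∧ Bit ν (Nat.pair t x)

/-- The conditions on a state `w` that contains the formula `ψ` under the valuation `ν`. -/
def LocalAt (b b₁ D w ψ ν : ℕ) : Prop :=
  Imp (tag ψ = 1) (EqTrue b ν ψ) ∧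
  Imp (tag ψ = 3) (¬ tag (arg ψ) = 0 ∧ Imp (tag (arg ψ) = 1) (¬ EqTrue b ν (arg ψ))) ∧
  Imp (tag ψ = 4) (Bit w (Nat.pair (argL ψ) ν) ∨ Bit w (Nat.pair (argR ψ) ν)) ∧
  Imp (tag ψ = 5) (Bit w (Nat.pair (argL ψ) ν) ∧ Bit w (Nat.pair (argR ψ) ν)) ∧
  Imp (tag ψ = 6) (ExLt b fun a => Bit D (Nat.pair (argS ψ) a) ∧ ExLt b₁ fun ν' =>
    Update b ν ν' (Nat.pair 0 (argL ψ)) a ∧ Bit w (Nat.pair (argR ψ) ν')) ∧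
  Imp (tag ψ = 7) (AllLt b fun a => Imp (Bit D (Nat.pair (argS ψ) a)) (AllLt b₁ fun ν' =>
    Imp (Update b ν ν' (Nat.pair 0 (argL ψ)) a) (Bit w (Nat.pair (argR ψ) ν'))))

/-- The state `w` contains a relational atom and the negation of the same atom. -/
def Clash (b w ψ ν ψ' ν' : ℕ) : Prop :=
  tag ψ = 2 ∧ tag ψ' = 3 ∧ tag (arg ψ') = 2 ∧ argL ψ = argL (arg ψ') ∧
  Bit w (Nat.pair ψ ν) ∧ Bit w (Nat.pair ψ' ν') ∧
  AllLt (argTerms (arg ψ')).length fun i => ExLt b fun a =>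
    Bit ν (Nat.pair ((argTerms ψ).getD i 0) a) ∧
    Bit ν' (Nat.pair ((argTerms (arg ψ')).getD i 0) a)

/-- The state `w` is locally consistent. -/
def Consistent (b b₁ D w : ℕ) : Prop :=
  (AllLt b fun ψ => AllLt b₁ fun ν => Imp (Bit w (Nat.pair ψ ν)) (LocalAt b b₁ D w ψ ν)) ∧
  AllLt b fun ψ => AllLt b₁ fun ν => AllLt b fun ψ' => AllLt b₁ fun ν' => ¬ Clash b w ψ ν ψ' ν'

/-- The conditions on a state `w'` that follows a state `w` containing `ψ` under `ν`. -/
def StepAt (w w' ψ ν : ℕ) : Prop :=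
  Imp (tag ψ = 8) (Bit w' (Nat.pair (arg ψ) ν)) ∧
  Imp (tag ψ = 9) (Bit w (Nat.pair (argR ψ) ν) ∨
    Bit w (Nat.pair (argL ψ) ν) ∧ Bit w' (Nat.pair ψ ν)) ∧
  Imp (tag ψ = 10) (Bit w (Nat.pair (argR ψ) ν) ∧
    (Bit w (Nat.pair (argL ψ) ν) ∨ Bit w' (Nat.pair ψ ν)))

/-- The state `w'` can follow the state `w`. -/
def Step (b b₁ w w' : ℕ) : Prop :=
  AllLt b fun ψ => AllLt b₁ fun ν => Imp (Bit w (Nat.pair ψ ν)) (StepAt w w' ψ ν)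

/-- In the state `w`, no fulfilment of the formula `ψ` under `ν` is pending. -/
def Met (w ψ ν : ℕ) : Prop :=
  Imp (Bit w (Nat.pair ψ ν)) (Imp (tag ψ = 9) (Bit w (Nat.pair (argR ψ) ν)))

/-- Every pending until formula of `w` can be approached within `W` along the orders `O`. -/
def Approach (b b₁ b₂ W O w : ℕ) : Prop :=
  AllLt b fun ψ => AllLt b₁ fun ν => Met w ψ ν ∨ ExLt b₂ fun w' =>
    Bit W w' ∧ Step b b₁ w w' ∧ Bit O (Nat.pair (Nat.pair ψ ν) (Nat.pair w' w))

/-- `O` codes a family of strict orders on states. -/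
def StrictOrders (b b₁ b₂ O : ℕ) : Prop :=
  AllLt b fun ψ => AllLt b₁ fun ν => AllLt b₂ fun w =>
    ¬ Bit O (Nat.pair (Nat.pair ψ ν) (Nat.pair w w)) ∧
    AllLt b₂ fun w' => AllLt b₂ fun w'' =>
      Imp (Bit O (Nat.pair (Nat.pair ψ ν) (Nat.pair w w')))
        (Imp (Bit O (Nat.pair (Nat.pair ψ ν) (Nat.pair w' w'')))
          (Bit O (Nat.pair (Nat.pair ψ ν) (Nat.pair w w''))))

/-- The valuation `ν` gives the term `t` exactly one value, which belongs to the sort `s`. -/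
def Denotes (b D s ν t : ℕ) : Prop :=
  ExLt b fun a => Bit D (Nat.pair s a) ∧ AllLt b fun x => Bit ν (Nat.pair t x) ↔ x = a

/-- `D` codes non-empty universes and `ν` a sort-respecting valuation of constants and variables. -/
def Interprets (b n : ℕ) (cs : List ℕ) (D ν : ℕ) : Prop :=
  (AllLt n fun s => ExLt b fun a => Bit D (Nat.pair s a)) ∧
  (AllLt cs.length fun c => Denotes b D (cs.getD c 0) ν (Nat.pair 1 c)) ∧
  AllLt n fun s => AllLt b fun x => Imp (Nat.pair 0 (Nat.pair s x) < b)
    (Denotes b D s ν (Nat.pair 0 (Nat.pair s x)))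

/-- `W` codes a set of states in which a fair path starts from every state. -/
def FairStates (b b₁ b₂ D W O : ℕ) : Prop :=
  StrictOrders b b₁ b₂ O ∧ AllLt b₂ fun w => Imp (Bit W w) (Consistent b b₁ D w ∧
    (ExLt b₂ fun w' => Bit W w' ∧ Step b b₁ w w') ∧ Approach b b₁ b₂ W O w)

/-- There is a certificate for the satisfiability of `φ` in universes of size at most `b`. -/
def SatCode (b b₁ b₂ b₃ n : ℕ) (cs : List ℕ) (φ : ℕ) : Prop :=
  ExLt b₁ fun D => ExLt b₁ fun ν => Interprets b n cs D ν ∧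
    ExLt b₃ fun W => ExLt b₃ fun O => FairStates b b₁ b₂ D W O ∧
      ExLt b₂ fun w => Bit W w ∧ Bit w (Nat.pair φ ν)

variable {α : Type} [Primcodable α]
variable {b b₁ b₂ b₃ n D W O w w' s t ν ν' v a φ ψ ψ' : α → ℕ} {cs : α → List ℕ}

@[fun_prop] theorem PrimRel.eqTrue (hb : PrimFun b) (hν : PrimFun ν) (hψ : PrimFun ψ) :
    PrimRel fun x => EqTrue (b x) (ν x) (ψ x) := by
  unfold EqTrue
  fun_prop

@[fun_prop] theorem PrimRel.update (hb : PrimFun b) (hν : PrimFun ν) (hν' : PrimFun ν')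
    (hv : PrimFun v) (ha : PrimFun a) :
    PrimRel fun x => Update (b x) (ν x) (ν' x) (v x) (a x) := by
  unfold Update
  fun_prop

@[fun_prop] theorem PrimRel.localAt (hb : PrimFun b) (hb₁ : PrimFun b₁) (hD : PrimFun D)
    (hw : PrimFun w) (hψ : PrimFun ψ) (hν : PrimFun ν) :
    PrimRel fun x => LocalAt (b x) (b₁ x) (D x) (w x) (ψ x) (ν x) := by
  unfold LocalAt
  fun_prop

@[fun_prop] theorem PrimRel.clash (hb : PrimFun b) (hw : PrimFun w) (hψ : PrimFun ψ)
    (hν : PrimFun ν) (hψ' : PrimFun ψ') (hν' : PrimFun ν') :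
    PrimRel fun x => Clash (b x) (w x) (ψ x) (ν x) (ψ' x) (ν' x) := by
  unfold Clash
  fun_prop

@[fun_prop] theorem PrimRel.consistent (hb : PrimFun b) (hb₁ : PrimFun b₁) (hD : PrimFun D)
    (hw : PrimFun w) : PrimRel fun x => Consistent (b x) (b₁ x) (D x) (w x) := by
  unfold Consistent
  fun_prop

@[fun_prop] theorem PrimRel.stepAt (hw : PrimFun w) (hw' : PrimFun w') (hψ : PrimFun ψ)
    (hν : PrimFun ν) : PrimRel fun x => StepAt (w x) (w' x) (ψ x) (ν x) := by
  unfold StepAt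
  fun_prop

@[fun_prop] theorem PrimRel.step (hb : PrimFun b) (hb₁ : PrimFun b₁) (hw : PrimFun w)
    (hw' : PrimFun w') : PrimRel fun x => Step (b x) (b₁ x) (w x) (w' x) := by
  unfold Step
  fun_prop

@[fun_prop] theorem PrimRel.met (hw : PrimFun w) (hψ : PrimFun ψ) (hν : PrimFun ν) :
    PrimRel fun x => Met (w x) (ψ x) (ν x) := by
  unfold Met
  fun_prop

@[fun_prop] theorem PrimRel.approach (hb : PrimFun b) (hb₁ : PrimFun b₁) (hb₂ : PrimFun b₂)
    (hW : PrimFun W) (hO : PrimFun O) (hw : PrimFun w) :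
    PrimRel fun x => Approach (b x) (b₁ x) (b₂ x) (W x) (O x) (w x) := by
  unfold Approach
  fun_prop

@[fun_prop] theorem PrimRel.strictOrders (hb : PrimFun b) (hb₁ : PrimFun b₁) (hb₂ : PrimFun b₂)
    (hO : PrimFun O) : PrimRel fun x => StrictOrders (b x) (b₁ x) (b₂ x) (O x) := by
  unfold StrictOrders
  fun_prop

@[fun_prop] theorem PrimRel.denotes (hb : PrimFun b) (hD : PrimFun D) (hs : PrimFun s)
    (hν : PrimFun ν) (ht : PrimFun t) :
    PrimRel fun x => Denotes (b x) (D x) (s x) (ν x) (t x) := by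
  unfold Denotes
  fun_prop

@[fun_prop] theorem PrimRel.interprets (hb : PrimFun b) (hn : PrimFun n) (hcs : PrimFun cs)
    (hD : PrimFun D) (hν : PrimFun ν) :
    PrimRel fun x => Interprets (b x) (n x) (cs x) (D x) (ν x) := by
  unfold Interprets
  fun_prop

@[fun_prop] theorem PrimRel.fairStates (hb : PrimFun b) (hb₁ : PrimFun b₁) (hb₂ : PrimFun b₂)
    (hD : PrimFun D) (hW : PrimFun W) (hO : PrimFun O) :
    PrimRel fun x => FairStates (b x) (b₁ x) (b₂ x) (D x) (W x) (O x) := by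
  unfold FairStates
  fun_prop

@[fun_prop] theorem PrimRel.satCode (hb : PrimFun b) (hb₁ : PrimFun b₁) (hb₂ : PrimFun b₂)
    (hb₃ : PrimFun b₃) (hn : PrimFun n) (hcs : PrimFun cs) (hφ : PrimFun φ) :
    PrimRel fun x => SatCode (b x) (b₁ x) (b₂ x) (b₃ x) (n x) (cs x) (φ x) := by
  unfold SatCode
  fun_prop

end Certificate

/-! ### Valuations and their codes -/

section Agreement

variable {n m k : ℕ} {τ : Signature (Fin n) (Fin m) (Fin k)}

/-- The valuation with code `ν` gives to all terms with code `< b` the codes of their values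
under `g`. -/
def Agrees {T : TemporalStructure.{u} τ} (e : ∀ s, T.U s → ℕ) (b ν : ℕ) (g : Valuation T) : Prop :=
  ∀ (s : Fin n) (t : Term τ s), t.code < b → ∀ a < b,
    (Bit ν (Nat.pair t.code a) ↔ a = e s (t.val T g))

/-- Keeps the universal clause of `LocalAt` from being vacuous: an updated valuation always has a
code within the bound. -/
theorem exists_update (b ν v a : ℕ) : ∃ ν' < 2 ^ b ^ 2, Update b ν ν' v a := by
  obtain ⟨c, hc, h⟩ := exists_pair_bits b fun t x => t = v ∧ x = a ∨ ¬ t = v ∧ Bit ν (Nat.pair t x)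
  exact ⟨c, hc, h⟩

variable {T : TemporalStructure.{u} τ} {e : ∀ s, T.U s → ℕ} {b ν ν' : ℕ} {g : Valuation T}

theorem Agrees.update (h : Agrees e b ν g) {s : Fin n} {x : ℕ} {d : T.U s}
    (hu : Update b ν ν' (Nat.pair 0 (Nat.pair s x)) (e s d)) :
    Agrees e b ν' (g.assign s x d) := by
  intro s' t ht a ha
  refine Iff.trans (hu _ ht a ha) ?_
  rw [h s' t ht a ha]
  cases t with
  | var s' x' =>
    by_cases hx : (s', x') = (s, x)
    · cases hx
      simp [Term.code, Term.val, Valuation.assign_self]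
    · have hne : ¬ (Term.var (σ := τ) s' x').code = Nat.pair 0 (Nat.pair s x) :=
        fun h => hx (varCode_injective h)
      simp only [hne, false_and, not_false_eq_true, true_and, false_or, Term.val,
        Valuation.assign_of_ne _ _ hx]
  | const c => simp [Term.code, Term.val]

/-- Two valuations are needed for clashes, where an atom and a negated atom may be read under
different ones. -/
theorem Agrees.exists_iff (h : Agrees e b ν g) {g' : Valuation T} (h' : Agrees e b ν' g')
    (he : ∀ s, Function.Injective (e s)) (heb : ∀ s x, e s x < b) {s : Fin n} {t t' : Term τ s}
    (ht : t.code < b) (ht' : t'.code < b) :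
    (ExLt b fun a => Bit ν (Nat.pair t.code a) ∧ Bit ν' (Nat.pair t'.code a)) ↔
      t.val T g = t'.val T g' := by
  constructor
  · rintro ⟨a, ha, h1, h2⟩
    exact he s (((h s t ht a ha).1 h1).symm.trans ((h' s t' ht' a ha).1 h2))
  · intro heq
    refine ⟨e s (t.val T g), heb _ _, (h s t ht _ (heb _ _)).2 rfl, ?_⟩
    rw [heq]
    exact (h' s t' ht' _ (heb _ _)).2 rfl

theorem Agrees.eqTrue_iff (h : Agrees e b ν g) (he : ∀ s, Function.Injective (e s))
    (heb : ∀ s x, e s x < b) {s : Fin n} {t t' : Term τ s}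
    (hχ : (Formula.eq t t').code < b) :
    EqTrue b ν (Formula.eq t t').code ↔ t.val T g = t'.val T g := by
  rw [EqTrue, Formula.code, argL_pair, argR_pair]
  exact h.exists_iff h he heb ((le_pair_pair_left _ _ _).trans_lt hχ)
    ((le_pair_pair_right _ _ _).trans_lt hχ)

theorem Formula.code_term_lt {r : Fin k} {ts : ∀ i, Term τ (τ.relSort r i)}
    (h : (Formula.rel r ts).code < b) (i : Fin (τ.relArity r)) : (ts i).code < b := by
  have hi : (ts i).code ∈ List.ofFn fun i => (ts i).code := List.mem_ofFn.2 ⟨i, rfl⟩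
  exact ((le_encode_of_mem hi).trans (le_pair_pair_right _ _ _)).trans_lt h

theorem Formula.argTerms_getD (r : Fin k) (ts : ∀ i, Term τ (τ.relSort r i))
    (i : Fin (τ.relArity r)) :
    (argTerms (Formula.rel r ts).code).getD i 0 = (ts i).code := by
  simp [Formula.code, List.getD_eq_getElem?_getD]

theorem Formula.length_argTerms (r : Fin k) (ts : ∀ i, Term τ (τ.relSort r i)) :
    (argTerms (Formula.rel r ts).code).length = τ.relArity r := by
  simp [Formula.code]

end Agreement

/-! ### Truth along a fair path -/

section Soundness

variable {n m k : ℕ} {τ : Signature (Fin n) (Fin m) (Fin k)}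

/-- Along a fair path of locally consistent states, the formulas contained in a state are true. -/
theorem Formula.sat_of_bit {T : TemporalStructure.{u} τ} {e : ∀ s, T.U s → ℕ} {b D : ℕ}
    {p : ℕ → ℕ} (he : ∀ s, Function.Injective (e s)) (heb : ∀ s x, e s x < b)
    (hD : ∀ s : Fin n, ∀ a < b, Bit D (Nat.pair s a) ↔ ∃ x, e s x = a)
    (hcons : ∀ i, Consistent b (2 ^ b ^ 2) D (p i))
    (hstep : ∀ i, Step b (2 ^ b ^ 2) (p i) (p (i + 1)))
    (hfair : ∀ ψ < b, ∀ ν < 2 ^ b ^ 2, ∀ i, ∃ j, i ≤ j ∧ Met (p j) ψ ν)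
    (hrel : ∀ i (r : Fin k) v, v ∈ T.rel i r ↔ ∃ ψ < b, ∃ ν < 2 ^ b ^ 2, tag ψ = 2 ∧
      argL ψ = r ∧ Bit (p i) (Nat.pair ψ ν) ∧
      ∀ j : Fin (τ.relArity r), Bit ν (Nat.pair ((argTerms ψ).getD j 0) (e _ (v j))))
    (χ : Formula τ) (hnnf : χ.IsNNF) (hχ : χ.code < b) :
    ∀ (i : ℕ) (g : Valuation T), ∀ ν < 2 ^ b ^ 2, Agrees e b ν g →
      Bit (p i) (Nat.pair χ.code ν) → χ.Sat T i g := by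
  induction χ with
  | tru => exact fun _ _ _ _ _ _ => trivial
  | eq t t' =>
    intro i g ν hν hg hbit
    exact (hg.eqTrue_iff he heb hχ).1 (((hcons i).1 _ hχ ν hν hbit).1 (by simp [Formula.code]))
  | rel r ts =>
    intro i g ν hν hg hbit
    refine (hrel i r _).2 ⟨_, hχ, ν, hν, by simp [Formula.code], by simp [Formula.code], hbit,
      fun j => ?_⟩
    rw [Formula.argTerms_getD]
    exact (hg _ _ (Formula.code_term_lt hχ j) _ (heb _ _)).2 rfl
  | neg φ _ =>
    intro i g ν hν hg hbit
    have hφ : φ.code < b := (Nat.right_le_pair _ _).trans_lt hχ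
    have hl := ((hcons i).1 _ hχ ν hν hbit).2.1 (by simp [Formula.code])
    simp only [Formula.code, arg_pair] at hl
    cases φ with
    | tru => exact (hl.1 (by simp [Formula.code])).elim
    | eq t t' =>
      exact fun h => hl.2 (by simp [Formula.code]) ((hg.eqTrue_iff he heb hφ).2 h)
    | rel r ts =>
      intro h
      obtain ⟨ψ, hψ, ν', hν', h1, h2, h3, h4⟩ := (hrel i r _).1 h
      -- The number `ψ` need not code a formula. This is harmless, since `Clash` takes the number of
      -- arguments from the negated atom, which is genuine here.
      refine (hcons i).2 ψ hψ ν' hν' _ hχ ν hν ⟨h1, by simp [Formula.code], ?_, ?_, h3, hbit, ?_⟩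
      · simp [Formula.code]
      · simp [Formula.code, h2]
      · simp only [Formula.code.eq_4, arg_pair, Formula.length_argTerms]
        intro j hj
        refine ⟨_, heb _ _, h4 ⟨j, hj⟩, ?_⟩
        have := Formula.argTerms_getD r ts ⟨j, hj⟩
        simp only at this
        rw [this]
        exact (hg _ _ (Formula.code_term_lt hφ _) _ (heb _ _)).2 rfl
    | _ => exact hnnf.elim
  | or φ ψ ihφ ihψ =>
    intro i g ν hν hg hbit
    have h := ((hcons i).1 _ hχ ν hν hbit).2.2.1 (by simp [Formula.code])
    simp only [Formula.code, argL_pair, argR_pair] at h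
    exact h.imp (ihφ hnnf.1 ((le_pair_pair_left _ _ _).trans_lt hχ) i g ν hν hg)
      (ihψ hnnf.2 ((le_pair_pair_right _ _ _).trans_lt hχ) i g ν hν hg)
  | and φ ψ ihφ ihψ =>
    intro i g ν hν hg hbit
    have h := ((hcons i).1 _ hχ ν hν hbit).2.2.2.1 (by simp [Formula.code])
    simp only [Formula.code, argL_pair, argR_pair] at h
    exact h.imp (ihφ hnnf.1 ((le_pair_pair_left _ _ _).trans_lt hχ) i g ν hν hg)
      (ihψ hnnf.2 ((le_pair_pair_right _ _ _).trans_lt hχ) i g ν hν hg)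
  | ex s x φ ih =>
    intro i g ν hν hg hbit
    obtain ⟨a, ha, haD, ν', hν', hu, h⟩ :=
      ((hcons i).1 _ hχ ν hν hbit).2.2.2.2.1 (by simp [Formula.code])
    simp only [Formula.code, argS_pair, argL_pair, argR_pair] at haD hu h
    obtain ⟨d, rfl⟩ := (hD s a ha).1 haD
    exact ⟨d, ih hnnf ((le_pair_pair_right _ _ _).trans_lt hχ) i _ ν' hν' (hg.update hu) h⟩
  | all s x φ ih =>
    intro i g ν hν hg hbit d
    obtain ⟨ν', hν', hu⟩ := exists_update b ν (Nat.pair 0 (Nat.pair s x)) (e s d)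
    have h := ((hcons i).1 _ hχ ν hν hbit).2.2.2.2.2 (by simp [Formula.code]) (e s d) (heb _ _)
    simp only [Formula.code, argS_pair, argL_pair, argR_pair] at h
    exact ih hnnf ((le_pair_pair_right _ _ _).trans_lt hχ) i _ ν' hν' (hg.update hu)
      (h ((hD s _ (heb _ _)).2 ⟨d, rfl⟩) ν' hν' hu)
  | next φ ih =>
    intro i g ν hν hg hbit
    have h := (hstep i _ hχ ν hν hbit).1 (by simp [Formula.code])
    simp only [Formula.code, arg_pair] at h
    exact ih hnnf ((Nat.right_le_pair _ _).trans_lt hχ) (i + 1) g ν hν hg h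
  | untl φ ψ ihφ ihψ =>
    intro i g ν hν hg hbit
    have hs : ∀ j, Bit (p j) (Nat.pair (Formula.untl φ ψ).code ν) →
        Bit (p j) (Nat.pair ψ.code ν) ∨ Bit (p j) (Nat.pair φ.code ν) ∧
          Bit (p (j + 1)) (Nat.pair (Formula.untl φ ψ).code ν) := by
      intro j hj
      simpa [Formula.code] using (hstep j _ hχ ν hν hj).2.1 (by simp [Formula.code])
    have hpend : ∀ j, (∀ k < j, ¬ Bit (p (i + k)) (Nat.pair ψ.code ν)) →
        Bit (p (i + j)) (Nat.pair (Formula.untl φ ψ).code ν) ∧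
          ∀ k < j, Bit (p (i + k)) (Nat.pair φ.code ν) := by
      intro j
      induction j with
      | zero => exact fun _ => ⟨hbit, fun k hk => absurd hk (Nat.not_lt_zero k)⟩
      | succ j ih =>
        intro hj
        obtain ⟨h1, h2⟩ := ih fun k hk => hj k (hk.trans (Nat.lt_succ_self j))
        obtain ⟨h3, h4⟩ := (hs _ h1).resolve_left (hj j (Nat.lt_succ_self j))
        refine ⟨h4, fun k hk => ?_⟩
        rcases Nat.lt_succ_iff_lt_or_eq.1 hk with hk | rfl
        · exact h2 k hk
        · exact h3
    -- If `ψ` never appeared, the until formula would be passed on forever; at a time when it is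
    -- met, `ψ` would be present after all.
    have hex : ∃ j, Bit (p (i + j)) (Nat.pair ψ.code ν) := by
      by_contra! hno
      obtain ⟨j, hij, hj⟩ := hfair _ hχ ν hν i
      obtain ⟨j, rfl⟩ := Nat.exists_eq_add_of_le hij
      have := hj (hpend j fun k _ => hno k).1 (by simp [Formula.code])
      simp only [Formula.code, argR_pair] at this
      exact hno j this
    classical
    refine ⟨Nat.find hex, ihψ hnnf.2 ((le_pair_pair_right _ _ _).trans_lt hχ) _ g ν hν hg
      (Nat.find_spec hex), fun k hk => ?_⟩
    exact ihφ hnnf.1 ((le_pair_pair_left _ _ _).trans_lt hχ) _ g ν hν hg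
      ((hpend _ fun k hk => Nat.find_min hex hk).2 k hk)
  | release φ ψ ihφ ihψ =>
    intro i g ν hν hg hbit j
    have hs : ∀ j, Bit (p j) (Nat.pair (Formula.release φ ψ).code ν) →
        Bit (p j) (Nat.pair ψ.code ν) ∧ (Bit (p j) (Nat.pair φ.code ν) ∨
          Bit (p (j + 1)) (Nat.pair (Formula.release φ ψ).code ν)) := by
      intro j hj
      simpa [Formula.code] using (hstep j _ hχ ν hν hj).2.2 (by simp [Formula.code])
    -- No fairness is needed here: a release formula may be passed on forever.
    have hpend : ∀ j, (∀ k < j, ¬ Bit (p (i + k)) (Nat.pair φ.code ν)) →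
        Bit (p (i + j)) (Nat.pair (Formula.release φ ψ).code ν) := by
      intro j
      induction j with
      | zero => exact fun _ => hbit
      | succ j ih =>
        intro hj
        exact (hs _ (ih fun k hk => hj k (hk.trans (Nat.lt_succ_self j)))).2.resolve_left
          (hj j (Nat.lt_succ_self j))
    by_cases hex : ∃ k < j, Bit (p (i + k)) (Nat.pair φ.code ν)
    · obtain ⟨k, hk, h⟩ := hex
      exact Or.inr ⟨k, hk, ihφ hnnf.1 ((le_pair_pair_left _ _ _).trans_lt hχ) _ g ν hν hg h⟩
    · push Not at hex
      exact Or.inl (ihψ hnnf.2 ((le_pair_pair_right _ _ _).trans_lt hχ) _ g ν hν hg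
        (hs _ (hpend j hex)).1)

end Soundness

/-! ### From certificates to models -/

section Soundness

variable {n m k : ℕ} {τ : Signature (Fin n) (Fin m) (Fin k)}

/-- The sorts of the constants, as part of the description of a signature. -/
def Signature.constSorts (τ : Signature (Fin n) (Fin m) (Fin k)) : List ℕ :=
  List.ofFn fun c => (τ.constSort c : ℕ)

theorem Signature.length_constSorts : τ.constSorts.length = m := by
  simp [Signature.constSorts]

theorem Signature.constSorts_getD (c : Fin m) : τ.constSorts.getD c 0 = τ.constSort c := by
  simp [Signature.constSorts, List.getD_eq_getElem?_getD]

/-- Strict orders on the states `< b₂` are well-founded. -/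
theorem wellFounded_of_strictOrders {b b₁ b₂ O : ℕ} (h : StrictOrders b b₁ b₂ O)
    (q : ℕ → Prop) (u : ℕ) : WellFounded fun w w' : {w : ℕ // w < b₂ ∧ q w} =>
      u.unpair.1 < b ∧ u.unpair.2 < b₁ ∧ Bit O (Nat.pair u (Nat.pair w w')) := by
  have : Finite {w : ℕ // w < b₂ ∧ q w} :=
    Set.Finite.to_subtype ((Set.finite_lt_nat b₂).subset fun w hw => hw.1)
  have h' := h u.unpair.1
  refine @Finite.wellFounded_of_trans_of_irrefl _ _ _ ⟨?_⟩ ⟨?_⟩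
  · rintro w w' w'' ⟨h1, h2, h3⟩ ⟨-, -, h4⟩
    have := (h _ h1 _ h2 w w.2.1).2 w' w'.2.1 w'' w''.2.1
    rw [Nat.pair_unpair] at this
    exact ⟨h1, h2, this h3 h4⟩
  · rintro w ⟨h1, h2, h3⟩
    have := (h _ h1 _ h2 w w.2.1).1
    rw [Nat.pair_unpair] at this
    exact this h3

/-- An obligation is a pair of a formula and a valuation, coded by one number; pairs outside the
bounds count as met. -/
theorem FairStates.exists_path {b b₁ b₂ D W O w : ℕ} (h : FairStates b b₁ b₂ D W O)
    (hw : w < b₂) (hwW : Bit W w) :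
    ∃ p : ℕ → ℕ, p 0 = w ∧ (∀ i, Consistent b b₁ D (p i)) ∧
      (∀ i, Step b b₁ (p i) (p (i + 1))) ∧
      ∀ ψ < b, ∀ ν < b₁, ∀ i, ∃ j, i ≤ j ∧ Met (p j) ψ ν := by
  obtain ⟨hO, hW⟩ := h
  obtain ⟨p, hp0, hp, hfair⟩ := exists_fair_path (X := {w : ℕ // w < b₂ ∧ Bit W w})
    (fun w w' => Step b b₁ w w')
    (fun u w => u.unpair.1 < b → u.unpair.2 < b₁ → Met w u.unpair.1 u.unpair.2)
    (fun u w w' => u.unpair.1 < b ∧ u.unpair.2 < b₁ ∧ Bit O (Nat.pair u (Nat.pair w w')))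
    (wellFounded_of_strictOrders hO _)
    (fun w => by
      obtain ⟨w', hw', h1, h2⟩ := (hW w w.2.1 w.2.2).2.1
      exact ⟨⟨w', hw', h1⟩, h2⟩)
    (fun u w => by
      by_cases h1 : u.unpair.1 < b
      · by_cases h2 : u.unpair.2 < b₁
        · refine ((hW w w.2.1 w.2.2).2.2 _ h1 _ h2).imp (fun h _ _ => h) ?_
          rintro ⟨w', hw', h3, h4, h5⟩
          rw [Nat.pair_unpair] at h5
          exact ⟨⟨w', hw', h3⟩, h4, h1, h2, h5⟩
        · exact Or.inl fun _ h => absurd h h2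
      · exact Or.inl fun h => absurd h h1)
    ⟨w, hw, hwW⟩
  refine ⟨fun i => (p i).1, congrArg Subtype.val hp0, fun i => (hW _ (p i).2.1 (p i).2.2).1, hp,
    fun ψ hψ ν hν i => ?_⟩
  obtain ⟨j, hij, hj⟩ := hfair (Nat.pair ψ ν) i
  rw [Nat.unpair_pair] at hj
  exact ⟨j, hij, hj hψ hν⟩

/-- Universes are read off from `D`, constants from the initial valuation, and relations at time `i`
from the positive atoms of the `i`-th state of a fair path. Only the bound on valuations must be
exact, so that updated valuations are covered; `b₂` and `b₃` are arbitrary. -/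
theorem Formula.satisfiable_of_satCode {b b₂ b₃ : ℕ} {φ : Formula τ} (hnnf : φ.IsNNF)
    (hφ : φ.code < b) (h : SatCode b (2 ^ b ^ 2) b₂ b₃ n τ.constSorts φ.code) :
    Formula.Satisfiable.{u} φ := by
  classical
  obtain ⟨D, -, ν₀, hν₀, ⟨hne, hconst, hvar⟩, W, -, O, -, hfs, w, hw, hwW, hwφ⟩ := h
  obtain ⟨p, rfl, hcons, hstep, hfair⟩ := hfs.exists_path hw hwW
  have hden : ∀ (s : Fin n) (t : ℕ), Denotes b D s ν₀ t →
      ∃ d : ULift.{u} {a : ℕ // a < b ∧ Bit D (Nat.pair s a)},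
        ∀ a < b, Bit ν₀ (Nat.pair t a) ↔ a = d.down.1 := by
    rintro s t ⟨a, ha, haD, h⟩
    exact ⟨⟨a, ha, haD⟩, h⟩
  have hdef : ∀ s : Fin n, Nonempty (ULift.{u} {a : ℕ // a < b ∧ Bit D (Nat.pair s a)}) :=
    fun s => by
      obtain ⟨a, ha, haD⟩ := hne s s.2
      exact ⟨⟨a, ha, haD⟩⟩
  have hconst' : ∀ c : Fin m, Denotes b D (τ.constSort c) ν₀ (Nat.pair 1 c) := fun c => by
    rw [← Signature.constSorts_getD]
    exact hconst c (by rw [Signature.length_constSorts]; exact c.2)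
  choose const hc using fun c : Fin m => hden _ _ (hconst' c)
  choose val hval using fun (s : Fin n) (x : ℕ) (h : x < b ∧ Nat.pair 0 (Nat.pair s x) < b) =>
    hden s _ (hvar s s.2 x h.1 h.2)
  let T : TemporalStructure.{u} τ :=
    { U := fun s => ULift.{u} {a : ℕ // a < b ∧ Bit D (Nat.pair s a)}
      nonempty := hdef
      const := const
      rel := fun i r => {v | ∃ ψ < b, ∃ ν < 2 ^ b ^ 2, tag ψ = 2 ∧ argL ψ = r ∧
        Bit (p i) (Nat.pair ψ ν) ∧ ∀ j : Fin (τ.relArity r),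
          Bit ν (Nat.pair ((argTerms ψ).getD j 0) (v j).down.1)} }
  -- Variables beyond the bound do not matter, as agreement concerns only terms with codes below
  -- `b`.
  let g : Valuation T := fun s x =>
    if h : x < b ∧ Nat.pair 0 (Nat.pair s x) < b then val s x h else (hdef s).some
  refine ⟨T, g, φ.sat_of_bit (T := T) (e := fun s d => d.down.1) (D := D) ?_ ?_ ?_ hcons hstep hfair
    (fun i r v => Iff.rfl) hnnf hφ 0 g ν₀ hν₀ ?_ hwφ⟩
  · intro s d d' h
    exact ULift.ext _ _ (Subtype.ext h)
  · exact fun s d => d.down.2.1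
  · exact fun s a ha => ⟨fun h => ⟨⟨a, ha, h⟩, rfl⟩, fun ⟨d, hd⟩ => hd ▸ d.down.2.2⟩
  · intro s t ht
    cases t with
    | var s x =>
      have hx : x < b ∧ Nat.pair 0 (Nat.pair s x) < b := ⟨(le_pair_pair_right _ _ _).trans_lt ht, ht⟩
      have : (Term.var (σ := τ) s x).val T g = val s x hx := dif_pos hx
      rw [this]
      exact hval s x hx
    | const c => exact hc c

end Soundness

/-! ### From models to certificates -/

section Completeness

variable {n m k : ℕ} {τ : Signature (Fin n) (Fin m) (Fin k)} {T : TemporalStructure.{u} τ}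

theorem Formula.Sat.untl_expand {φ ψ : Formula τ} {i : ℕ} {g : Valuation T}
    (h : (Formula.untl φ ψ).Sat T i g) :
    ψ.Sat T i g ∨ φ.Sat T i g ∧ (Formula.untl φ ψ).Sat T (i + 1) g := by
  obtain ⟨j, hj, h⟩ := h
  cases j with
  | zero => exact Or.inl hj
  | succ j =>
    refine Or.inr ⟨h 0 (Nat.succ_pos j), j, ?_, fun k hk => ?_⟩
    · rwa [Nat.add_assoc, Nat.add_comm 1]
    · rw [Nat.add_assoc, Nat.add_comm 1]
      exact h (k + 1) (Nat.succ_lt_succ hk)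

theorem Formula.Sat.release_expand {φ ψ : Formula τ} {i : ℕ} {g : Valuation T}
    (h : (Formula.release φ ψ).Sat T i g) :
    ψ.Sat T i g ∧ (φ.Sat T i g ∨ (Formula.release φ ψ).Sat T (i + 1) g) := by
  have h0 : ψ.Sat T i g := (h 0).resolve_right fun ⟨k, hk, _⟩ => Nat.not_lt_zero k hk
  refine ⟨h0, or_iff_not_imp_left.2 fun hφ j => ?_⟩
  rcases h (j + 1) with h | ⟨k, hk, h⟩
  · left
    rwa [Nat.add_assoc, Nat.add_comm 1]
  · right
    cases k with
    | zero => exact absurd h hφ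
    | succ k =>
      refine ⟨k, Nat.lt_of_succ_lt_succ hk, ?_⟩
      rwa [Nat.add_assoc, Nat.add_comm 1]

/-- The states `p i` consist of the formulas that are true at time `i`. -/
def Labels (e : ∀ s, T.U s → ℕ) (b : ℕ) (p : ℕ → ℕ) : Prop :=
  ∀ i, ∀ ψ < b, ∀ ν < 2 ^ b ^ 2, Bit (p i) (Nat.pair ψ ν) ↔
    ∃ χ : Formula τ, χ.code = ψ ∧ ∃ g : Valuation T, Agrees e b ν g ∧ χ.Sat T i g

variable {e : ∀ s, T.U s → ℕ} {b : ℕ} {p : ℕ → ℕ}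

theorem Labels.bit (hp : Labels e b p) {i ν : ℕ} {χ : Formula τ} {g : Valuation T}
    (hχ : χ.code < b) (hν : ν < 2 ^ b ^ 2) (hg : Agrees e b ν g) (h : χ.Sat T i g) :
    Bit (p i) (Nat.pair χ.code ν) :=
  (hp i _ hχ ν hν).2 ⟨χ, rfl, g, hg, h⟩

theorem Labels.localAt (hp : Labels e b p) (he : ∀ s, Function.Injective (e s))
    (heb : ∀ s x, e s x < b) {D : ℕ}
    (hD : ∀ s : Fin n, ∀ a < b, Bit D (Nat.pair s a) ↔ ∃ x, e s x = a) {i ν : ℕ}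
    {χ : Formula τ} {g : Valuation T} (hχ : χ.code < b) (hν : ν < 2 ^ b ^ 2)
    (hg : Agrees e b ν g) (h : χ.Sat T i g) : LocalAt b (2 ^ b ^ 2) D (p i) χ.code ν := by
  cases χ with
  | eq t t' =>
    have := (hg.eqTrue_iff he heb hχ).2 h
    simpa [LocalAt, Imp, Formula.code] using this
  | neg φ =>
    have hφ : φ.code < b := (Nat.right_le_pair _ _).trans_lt hχ
    cases φ with
    | tru => exact (h trivial).elim
    | eq t t' =>
      have := fun h' => h ((hg.eqTrue_iff he heb hφ).1 h')
      simpa [LocalAt, Imp, Formula.code] using this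
    | _ => simp [LocalAt, Imp, Formula.code]
  | or φ ψ =>
    have := Or.imp (hp.bit ((le_pair_pair_left _ _ _).trans_lt hχ) hν hg)
      (hp.bit ((le_pair_pair_right _ _ _).trans_lt hχ) hν hg) h
    simpa [LocalAt, Imp, Formula.code] using this
  | and φ ψ =>
    have := And.imp (hp.bit ((le_pair_pair_left _ _ _).trans_lt hχ) hν hg)
      (hp.bit ((le_pair_pair_right _ _ _).trans_lt hχ) hν hg) h
    simpa [LocalAt, Imp, Formula.code] using this
  | ex s x φ =>
    obtain ⟨d, hd⟩ := h
    obtain ⟨ν', hν', hu⟩ := exists_update b ν (Nat.pair 0 (Nat.pair s x)) (e s d)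
    have := hp.bit ((le_pair_pair_right _ _ _).trans_lt hχ) hν' (hg.update hu) hd
    simp only [LocalAt, Imp, Formula.code, tag_pair, argS_pair, argL_pair, argR_pair]
    refine ⟨by simp, by simp, by simp, by simp, fun _ => ?_, by simp⟩
    exact ⟨e s d, heb _ _, (hD s _ (heb _ _)).2 ⟨d, rfl⟩, ν', hν', hu, this⟩
  | all s x φ =>
    simp only [LocalAt, Imp, Formula.code, tag_pair, argS_pair, argL_pair, argR_pair]
    refine ⟨by simp, by simp, by simp, by simp, by simp, fun _ a ha haD ν' hν' hu => ?_⟩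
    obtain ⟨d, rfl⟩ := (hD s a ha).1 haD
    exact hp.bit ((le_pair_pair_right _ _ _).trans_lt hχ) hν' (hg.update hu) (h d)
  | _ => simp [LocalAt, Imp, Formula.code]

theorem Labels.consistent (hp : Labels e b p) (he : ∀ s, Function.Injective (e s))
    (heb : ∀ s x, e s x < b) {D : ℕ}
    (hD : ∀ s : Fin n, ∀ a < b, Bit D (Nat.pair s a) ↔ ∃ x, e s x = a) (i : ℕ) :
    Consistent b (2 ^ b ^ 2) D (p i) := by
  constructor
  · intro ψ hψ ν hν h
    obtain ⟨χ, rfl, g, hg, h⟩ := (hp i ψ hψ ν hν).1 h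
    exact hp.localAt he heb hD hψ hν hg h
  · rintro ψ hψ ν hν ψ' hψ' ν' hν' ⟨h1, h2, h3, h4, h5, h6, h7⟩
    obtain ⟨χ, rfl, g, hg, h⟩ := (hp i ψ hψ ν hν).1 h5
    obtain ⟨χ', rfl, g', hg', h'⟩ := (hp i ψ' hψ' ν' hν').1 h6
    cases χ with
    | rel r ts =>
      cases χ' with
      | neg φ =>
        have hφ : φ.code < b := (Nat.right_le_pair _ _).trans_lt hψ'
        cases φ with
        | rel r' ts' =>
          obtain rfl : r = r' := by simpa [Formula.code, Fin.val_inj] using h4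
          rw [Formula.code.eq_4, arg_pair, Formula.length_argTerms] at h7
          refine h' ?_
          have : (fun j => (ts' j).val T g') = fun j => (ts j).val T g := by
            funext j
            have hj := h7 j j.2
            dsimp only at hj
            rw [Formula.argTerms_getD, Formula.argTerms_getD] at hj
            exact ((hg.exists_iff hg' he heb (Formula.code_term_lt hψ j)
              (Formula.code_term_lt hφ j)).1 hj).symm
          simp only [Formula.Sat] at h ⊢
          rwa [this]
        | _ => simp [Formula.code] at h3
      | _ => simp [Formula.code] at h2
    | _ => simp [Formula.code] at h1

theorem Labels.step (hp : Labels e b p) (i : ℕ) :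
    Step b (2 ^ b ^ 2) (p i) (p (i + 1)) := by
  intro ψ hψ ν hν h
  obtain ⟨χ, rfl, g, hg, h⟩ := (hp i ψ hψ ν hν).1 h
  cases χ with
  | next φ =>
    have := hp.bit ((Nat.right_le_pair _ _).trans_lt hψ) hν hg (show φ.Sat T (i + 1) g from h)
    simpa [StepAt, Imp, Formula.code] using this
  | untl φ χ =>
    have := h.untl_expand.imp (hp.bit ((le_pair_pair_right _ _ _).trans_lt hψ) hν hg)
      (And.imp (hp.bit ((le_pair_pair_left _ _ _).trans_lt hψ) hν hg) (hp.bit hψ hν hg))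
    simpa [StepAt, Imp, Formula.code] using this
  | release φ χ =>
    have := h.release_expand.imp (hp.bit ((le_pair_pair_right _ _ _).trans_lt hψ) hν hg)
      (Or.imp (hp.bit ((le_pair_pair_left _ _ _).trans_lt hψ) hν hg) (hp.bit hψ hν hg))
    simpa [StepAt, Imp, Formula.code] using this
  | _ => simp [StepAt, Imp, Formula.code]

theorem Labels.exists_met (hp : Labels e b p) {ψ ν : ℕ} (hψ : ψ < b) (hν : ν < 2 ^ b ^ 2)
    (i : ℕ) : ∃ j, Met (p (i + j)) ψ ν := by
  by_cases h : Met (p i) ψ ν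
  · exact ⟨0, h⟩
  · simp only [Met, Imp, Classical.not_imp] at h
    obtain ⟨h1, h2, -⟩ := h
    obtain ⟨χ, rfl, g, hg, h⟩ := (hp i ψ hψ ν hν).1 h1
    cases χ with
    | untl φ χ =>
      obtain ⟨j, hj, -⟩ := h
      have := hp.bit ((le_pair_pair_right _ _ _).trans_lt hψ) hν hg hj
      exact ⟨j, fun _ _ => by simpa [Formula.code] using this⟩
    | _ => simp [Formula.code] at h2

/-- The shortest time until the formula `ψ` under `ν` is met, starting from the state `w`. -/
noncomputable def timeToMeet (p : ℕ → ℕ) (ψ ν w : ℕ) : ℕ :=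
  sInf {j | ∃ i, p i = w ∧ Met (p (i + j)) ψ ν}

/-- A state may recur with different waiting times. At an occurrence `i'` with the shortest one,
either nothing is pending or the state at `i' + 1` has a smaller waiting time. It is also a
successor of `p i`, since `Step` depends on the states alone. Thus no periodic run has to be
extracted from the model. -/
theorem Labels.met_or_timeToMeet_lt (hp : Labels e b p) {ψ ν : ℕ} (hψ : ψ < b)
    (hν : ν < 2 ^ b ^ 2) (i : ℕ) : Met (p i) ψ ν ∨
      ∃ i', Step b (2 ^ b ^ 2) (p i) (p i') ∧
        timeToMeet p ψ ν (p i') < timeToMeet p ψ ν (p i) := by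
  obtain ⟨j, hj⟩ := hp.exists_met hψ hν i
  obtain ⟨i', hi', h⟩ := Nat.sInf_mem (s := {j | ∃ i', p i' = p i ∧ Met (p (i' + j)) ψ ν})
    ⟨j, i, rfl, hj⟩
  change Met (p (i' + timeToMeet p ψ ν (p i))) ψ ν at h
  cases hr : timeToMeet p ψ ν (p i) with
  | zero =>
    rw [hr] at h
    exact Or.inl (hi' ▸ h)
  | succ r =>
    rw [hr] at h
    refine Or.inr ⟨i' + 1, hi' ▸ hp.step i', Nat.lt_succ_of_le (Nat.sInf_le ⟨i' + 1, rfl, ?_⟩)⟩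
    rwa [Nat.add_assoc, Nat.add_comm 1]

/-- Makes coded valuations well defined: the code of a term determines its value, across sorts. -/
theorem Term.code_val_eq {g : Valuation T} {s s' : Fin n} (t : Term τ s) (t' : Term τ s')
    (h : t.code = t'.code) : e s (t.val T g) = e s' (t'.val T g) := by
  cases t with
  | var s x =>
    cases t' with
    | var s' x' =>
      simp only [Term.code, Nat.pair_eq_pair, true_and, Fin.val_inj] at h
      obtain ⟨rfl, rfl⟩ := h
      rfl
    | const c => simp [Term.code] at h
  | const c =>
    cases t' with
    | var s' x' => simp [Term.code] at h
    | const c' =>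
      simp only [Term.code, Nat.pair_eq_pair, true_and, Fin.val_inj] at h
      subst h
      rfl

theorem exists_agrees (e : ∀ s, T.U s → ℕ) (b : ℕ) (g : Valuation T) :
    ∃ ν < 2 ^ b ^ 2, Agrees e b ν g := by
  obtain ⟨ν, hν, h⟩ := exists_pair_bits b fun t a =>
    ∃ (s : Fin n) (t' : Term τ s), t'.code = t ∧ a = e s (t'.val T g)
  refine ⟨ν, hν, fun s t ht a ha => (h _ ht a ha).trans ⟨?_, fun h => ⟨s, t, rfl, h⟩⟩⟩
  rintro ⟨s', t', h1, rfl⟩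
  exact Term.code_val_eq t' t h1

theorem Agrees.interprets {ν D : ℕ} {g : Valuation T} (hg : Agrees e b ν g)
    (heb : ∀ s x, e s x < b) (hm : ∀ c < m, Nat.pair 1 c < b)
    (hD : ∀ s : Fin n, ∀ a < b, Bit D (Nat.pair s a) ↔ ∃ x, e s x = a) :
    Interprets b n τ.constSorts D ν := by
  have hmem : ∀ (s : Fin n) (x : T.U s), Bit D (Nat.pair s (e s x)) :=
    fun s x => (hD s _ (heb s x)).2 ⟨x, rfl⟩
  have hden : ∀ (s : Fin n) (t : Term τ s), t.code < b → Denotes b D s ν t.code :=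
    fun s t ht => ⟨e s (t.val T g), heb _ _, hmem _ _, hg s t ht⟩
  have hvar : ∀ (s : Fin n) (x : ℕ), Nat.pair 0 (Nat.pair s x) < b →
      Denotes b D s ν (Nat.pair 0 (Nat.pair s x)) := fun s x => hden s (.var s x)
  have hconst : ∀ c : Fin m, Denotes b D (τ.constSort c) ν (Nat.pair 1 c) := fun c =>
    hden _ (.const c) (hm c c.2)
  refine ⟨fun s hs => ?_, fun c hc => ?_, fun s hs x _ => hvar ⟨s, hs⟩ x⟩
  · obtain ⟨x⟩ := T.nonempty ⟨s, hs⟩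
    exact ⟨e _ x, heb _ _, hmem ⟨s, hs⟩ x⟩
  · rw [Signature.length_constSorts] at hc
    have h := hconst ⟨c, hc⟩
    rw [← Signature.constSorts_getD] at h
    exact h

theorem le_two_pow_sq (b : ℕ) : b ≤ 2 ^ b ^ 2 :=
  (Nat.le_self_pow two_ne_zero b).trans Nat.lt_two_pow_self.le

/-- Elements are numbered, `W` consists of the states that occur at some time, and `O` compares
`timeToMeet`. The tower of bounds follows the types: `b₁` for universes and valuations (sets of
pairs), `b₂` for states (sets of pairs of a formula and a valuation), `b₃` for `O`, a set of pairs
of pairs. -/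
theorem Formula.satCode_of_sat {φ : Formula τ} (hn : n ≤ b) (hm : ∀ c < m, Nat.pair 1 c < b)
    (hφ : φ.code < b) (hT : ∀ s, Finite (T.U s) ∧ Nat.card (T.U s) ≤ b) {g : Valuation T}
    (h : φ.Sat T 0 g) {b₁ b₂ b₃ : ℕ} (hb₁ : b₁ = 2 ^ b ^ 2) (hb₂ : b₂ = 2 ^ b₁ ^ 2)
    (hb₃ : b₃ = 2 ^ (b₂ ^ 2) ^ 2) : SatCode b b₁ b₂ b₃ n τ.constSorts φ.code := by
  have hb01 : b ≤ b₁ := hb₁ ▸ le_two_pow_sq b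
  have hb12 : b₁ ≤ b₂ := hb₂ ▸ le_two_pow_sq b₁
  have hb2 : b₂ ≤ (b₂ ^ 2) ^ 2 :=
    (Nat.le_self_pow two_ne_zero _).trans (Nat.le_self_pow two_ne_zero _)
  have hfin : ∀ s, Finite (T.U s) := fun s => (hT s).1
  let e : ∀ s, T.U s → ℕ := fun s x => (Finite.equivFin (T.U s) x : ℕ)
  have he : ∀ s, Function.Injective (e s) := fun s =>
    Fin.val_injective.comp (Finite.equivFin (T.U s)).injective
  have heb : ∀ s x, e s x < b := fun s x => (Fin.is_lt _).trans_le (hT s).2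
  obtain ⟨D, hDb, hD⟩ := exists_pair_bits b fun s a =>
    ∃ (hs : s < n) (x : T.U ⟨s, hs⟩), e _ x = a
  have hD' : ∀ s : Fin n, ∀ a < b, Bit D (Nat.pair s a) ↔ ∃ x, e s x = a := fun s a ha =>
    (hD s (s.2.trans_le hn) a ha).trans ⟨fun ⟨_, h⟩ => h, fun h => ⟨s.2, h⟩⟩
  obtain ⟨ν, hν, hg⟩ := exists_agrees e b g
  choose p hpb hp using fun i => exists_pair_bits b₁ fun ψ ν =>
    ∃ χ : Formula τ, χ.code = ψ ∧ ∃ g : Valuation T, Agrees e b ν g ∧ χ.Sat T i g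
  rw [← hb₂] at hpb
  have hlab : Labels e b p := fun i ψ hψ ν hν =>
    hp i ψ (hψ.trans_le hb01) ν (hb₁ ▸ hν)
  -- States are below `b₂`; the larger range lets the single bound `b₃` serve both `W` and `O`.
  obtain ⟨W, hWb, hW⟩ := exists_bits ((b₂ ^ 2) ^ 2) fun w => ∃ i, p i = w
  obtain ⟨O, hOb, hO⟩ := exists_pair_bits (b₂ ^ 2) fun u v =>
    timeToMeet p u.unpair.1 u.unpair.2 v.unpair.1 < timeToMeet p u.unpair.1 u.unpair.2 v.unpair.2
  have hWp : ∀ i, Bit W (p i) := fun i => (hW _ ((hpb i).trans_le hb2)).2 ⟨i, rfl⟩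
  have hO' : ∀ ψ < b, ∀ ν < b₁, ∀ w < b₂, ∀ w' < b₂,
      Bit O (Nat.pair (Nat.pair ψ ν) (Nat.pair w w')) ↔
        timeToMeet p ψ ν w < timeToMeet p ψ ν w' := by
    intro ψ hψ ν hν w hw w' hw'
    have := hO _ (pair_lt_sq (hψ.trans_le (hb01.trans hb12)) (hν.trans_le hb12)) _
      (pair_lt_sq hw hw')
    simpa using this
  rw [← hb₃] at hWb hOb
  subst hb₁
  refine ⟨D, hDb, ν, hν, hg.interprets heb hm hD', W, hWb, O, hOb, ⟨?_, ?_⟩, p 0, hpb 0, hWp 0,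
    hlab.bit hφ hν hg h⟩
  · refine fun ψ hψ ν hν w hw => ⟨?_, fun w' hw' w'' hw'' h1 h2 => ?_⟩
    · rw [hO' ψ hψ ν hν w hw w hw]
      exact lt_irrefl _
    · rw [hO' ψ hψ ν hν w hw w' hw'] at h1
      rw [hO' ψ hψ ν hν w' hw' w'' hw''] at h2
      exact (hO' ψ hψ ν hν w hw w'' hw'').2 (h1.trans h2)
  · intro w hw hwW
    obtain ⟨i, rfl⟩ := (hW w (hw.trans_le hb2)).1 hwW
    refine ⟨hlab.consistent he heb hD' i, ⟨p (i + 1), hpb _, hWp _, hlab.step i⟩,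
      fun ψ hψ ν hν => (hlab.met_or_timeToMeet_lt hψ hν i).imp_right ?_⟩
    rintro ⟨i', h1, h2⟩
    exact ⟨p i', hpb _, hWp _, h1, (hO' ψ hψ ν hν _ (hpb _) _ (hpb _)).2 h2⟩

end Completeness

/-! ### The decision procedure -/

section Decision

variable {n m k : ℕ} {τ : Signature (Fin n) (Fin m) (Fin k)}

/-- Allows the bound on the universes to be computed from the code without determining the prefix.
-/
theorem Formula.quantPrefix_le_code (φ : Formula τ) : φ.quantPrefix ≤ φ.code := by
  have h : ∀ a b c : ℕ, c + 1 ≤ Nat.pair (a + 1) (Nat.pair b c) := fun a b c => by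
    have h1 := Nat.add_le_pair (a + 1) (Nat.pair b c)
    have h2 := Nat.right_le_pair b c
    omega
  induction φ with
  | ex s x φ ih => exact (Nat.succ_le_succ ih).trans (h _ _ _)
  | all s x φ ih => exact (Nat.succ_le_succ ih).trans (h _ _ _)
  | _ => exact Nat.zero_le _

/-- A bound for the codes of the sorts, constants, formulas and universes that occur in a
certificate. -/
def certBound (n m φ : ℕ) : ℕ :=
  (m + 2) ^ 2 ^ φ + (Nat.pair 1 m + (φ + (n + 1)))

/-- The decision procedure, as a predicate of the codes of a signature and a formula. -/
def Accepts (x : (ℕ × List ℕ × List (List ℕ)) × ℕ) : Prop :=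
  BSCode (certBound x.1.1 x.1.2.1.length x.2) x.1.1 x.2 ∧
  SatCode (certBound x.1.1 x.1.2.1.length x.2)
    (2 ^ certBound x.1.1 x.1.2.1.length x.2 ^ 2)
    (2 ^ (2 ^ certBound x.1.1 x.1.2.1.length x.2 ^ 2) ^ 2)
    (2 ^ ((2 ^ (2 ^ certBound x.1.1 x.1.2.1.length x.2 ^ 2) ^ 2) ^ 2) ^ 2) x.1.1 x.1.2.1 x.2

theorem primrecPred_accepts : PrimrecPred Accepts := by
  have h : PrimRel Accepts := by
    unfold Accepts certBound
    fun_prop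
  exact h

/-- Soundness of the search uses only negation normal form; the small model property enters in the
converse, where it guarantees that a certificate fits below `certBound`. -/
theorem accepts_iff (φ : Formula τ) :
    Accepts (τ.code, φ.code) ↔ φ.IsBS ∧ Formula.Satisfiable.{u} φ := by
  have hlen : (List.ofFn fun c => (τ.constSort c : ℕ)).length = m := List.length_ofFn
  unfold Accepts Signature.code
  dsimp only
  rw [hlen]
  have hφ : φ.code < certBound n m φ.code := by
    unfold certBound
    omega
  rw [bsCode_iff hφ]
  refine and_congr_right fun hBS => ⟨φ.satisfiable_of_satCode hBS.2.1 hφ, fun h => ?_⟩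
  obtain ⟨T, g, hT, hg⟩ := hBS.exists_small_model h
  refine Formula.satCode_of_sat ?_ (fun c hc => ?_) hφ (fun s => ⟨(hT s).1, (hT s).2.trans ?_⟩) hg
    rfl rfl rfl
  · unfold certBound
    omega
  · have := Nat.pair_lt_pair_right 1 hc
    unfold certBound
    omega
  · rw [Nat.card_eq_fintype_card, Fintype.card_fin]
    exact (Nat.pow_le_pow_right (by omega) (Nat.pow_le_pow_right (by omega)
      φ.quantPrefix_le_code)).trans (Nat.le_add_right _ _)

end Decision

end FOLTL

theorem mainTheorem2 :
    (∀ (S C R : Type*) [DecidableEq S] [Finite S] [Nonempty S] [Finite C] [Finite R]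
        (σ : FOLTL.Signature S C R) (φ : FOLTL.Formula σ), φ.IsBS →
        (FOLTL.Formula.Satisfiable.{u} φ ↔ FOLTL.Formula.FinitelySatisfiable.{u} φ)) ∧
    (∃ f : (ℕ × List ℕ × List (List ℕ)) × ℕ → Bool, Computable f ∧
      ∀ (n m k : ℕ), 0 < n → ∀ (σ : FOLTL.Signature (Fin n) (Fin m) (Fin k))
        (φ : FOLTL.Formula σ),
        f (σ.code, φ.code) = true ↔ φ.IsBS ∧ FOLTL.Formula.Satisfiable.{u} φ) := by
  refine ⟨fun S C R _ _ _ _ _ σ φ hφ => hφ.satisfiable_iff_finitelySatisfiable, ?_⟩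
  obtain ⟨_, h⟩ := FOLTL.primrecPred_accepts
  refine ⟨fun x => decide (FOLTL.Accepts x), h.to_comp, fun n m k _ σ φ => ?_⟩
  rw [decide_eq_true_iff]
  exact FOLTL.accepts_iff φ
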